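/- Let $L$ be a finite-dimensional solvable restricted Lie algebra over a field $\mathbb F$ of prime characteristic $p$, with $p$-map $x\mapsto x^{[p]}$, let $u(L)$ be its restricted universal enveloping algebra with Jacobson radical $J=\mathrm{Jac}(u(L))$, and let $P_L(\mathbb F)$ be the projective cover of the trivial irreducible $u(L)$-module $\mathbb F$, i.e. a projective $u(L)$-module with a surjection onto $\mathbb F$ whose kernel is contained in $J\,P_L(\mathbb F)$. For an irreducible $L$-module $S$ and a chief series $0=L_0\subset L_1\subset\cdots\subset L_n=L$ (a chain of ideals of $L$ such that each $L_j/L_{j-1}$ is a minimal non-zero ideal of $L/L_{j-1}$), let $[L:S]_{\mathrm{split}}$ be the number of indices $j$ such that $L_j/L_{j-1}$ is abelian, is isomorphic to $S$ as an $L$-module, and the sequence $0\to L_j/L_{j-1}\to L/L_{j-1}\to L/L_j\to 0$ splits in the category of Lie algebras. For a module $M$ of finite length, let $[M:S]$ be the number of factors isomorphic to $S$ in a composition series of $M$. Then the second Loewy layer $J P_L(\mathbb F)/J^2P_L(\mathbb F)$ has finite length, and for every irreducible restricted $L$-module $S$, and for any choice of the chief series of $L$ and of the composition series of the layer, $$[J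 P_L(\mathbb F)/J^2P_L(\mathbb F):S]=\begin{cases}[L:S]_{\mathrm{split}} & \text{if } S\not\cong\mathbb F,\\[2pt] [L:\mathbb F]_{\mathrm{split}}-\dim_{\mathbb F}\bigl(\langle L^{[p]}\rangle_{\mathbb F}/([L,L]\cap\langle L^{[p]}\rangle_{\mathbb F})\bigr) & \text{if } S\cong\mathbb F,\end{cases}$$ where $\langle L^{[p]}\rangle_{\mathbb F}$ is the $\mathbb F$-subspace of $L$ spanned by all $x^{[p]}$ with $x\in L$. -/

import Mathlib

noncomputable section

/-! ## Restricted Lie algebras -/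

/-- `lieWordSum x y n k` is the coefficient of `X ^ k` in `(ad (X • x + y)) ^ n (x)`, computed in
the Lie algebra `F[X] ⊗ L` of polynomials in `X` with coefficients in `L`. The recursion is
`(ad (X • x + y)) ^ (n + 1) (x) = X • ⁅x, (ad (X • x + y)) ^ n (x)⁆ + ⁅y, (ad (X • x + y)) ^ n (x)⁆`,
read off coefficient by coefficient. -/
def lieWordSum {L : Type*} [LieRing L] (x y : L) : ℕ → ℕ → L
  | 0, 0 => x
  | 0, _ + 1 => 0
  | n + 1, 0 => ⁅y, lieWordSum x y n 0⁆
  | n + 1, k + 1 => ⁅x, lieWordSum x y n k⁆ + ⁅y, lieWordSum x y n (k + 1)⁆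

/-- The Lie polynomials `s_i(x, y)`, for `1 ≤ i ≤ p - 1`, of Jacobson's formula for `(x + y) ^ p`:
`i • s_i(x, y)` is the coefficient of `X ^ (i - 1)` in `(ad (X • x + y)) ^ (p - 1) (x)`.
The number `i` is invertible in `F` when `F` has characteristic `p` and `1 ≤ i ≤ p - 1`. -/
def jacobsonTerm (F : Type*) {L : Type*} [Field F] [LieRing L] [LieAlgebra F L] (p : ℕ) (x y : L)
    (i : ℕ) : L :=
  (i : F)⁻¹ • lieWordSum x y (p - 1) (i - 1)

/-- A restricted Lie algebra over a field `F` of prime characteristic `p`: a Lie algebra together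
with a `p`-map `x ↦ x^[p]`. -/
class RestrictedLieAlgebra (F : Type*) (p : ℕ) (L : Type*) [Field F] [LieRing L]
    [LieAlgebra F L] where
  /-- The `p`-map `x ↦ x^[p]`. -/
  pMap : L → L
  ad_pMap : ∀ x : L, LieAlgebra.ad F L (pMap x) = LieAlgebra.ad F L x ^ p
  pMap_smul : ∀ (a : F) (x : L), pMap (a • x) = a ^ p • pMap x
  pMap_add : ∀ x y : L,
    pMap (x + y) = pMap x + pMap y + ∑ i ∈ Finset.Icc 1 (p - 1), jacobsonTerm F p x y i

open RestrictedLieAlgebra (pMap)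

/-- A module `M` over a restricted Lie algebra `L` is restricted if `x^[p]` acts on `M` as the
`p`-th power of the action of `x`, for every `x` in `L`. -/
def IsRestrictedModule (F : Type*) (p : ℕ) (L M : Type*) [Field F] [LieRing L] [LieAlgebra F L]
    [RestrictedLieAlgebra F p L] [AddCommGroup M] [Module F M] [LieRingModule L M]
    [LieModule F L M] : Prop :=
  ∀ x : L, LieModule.toEnd F L M (pMap F p x) = LieModule.toEnd F L M x ^ p

/-! ## The restricted universal enveloping algebra -/

/-- The relations `x ^ p = x^[p]`, for `x` in `L`, in the universal enveloping algebra of `L`. -/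
inductive RestrictedEnvelopingAlgebra.Rel (F : Type*) (p : ℕ) (L : Type*) [Field F] [LieRing L]
    [LieAlgebra F L] [RestrictedLieAlgebra F p L] :
    UniversalEnvelopingAlgebra F L → UniversalEnvelopingAlgebra F L → Prop
  | of (x : L) : RestrictedEnvelopingAlgebra.Rel F p L
      (UniversalEnvelopingAlgebra.ι F x ^ p) (UniversalEnvelopingAlgebra.ι F (pMap F p x))

/-- The restricted universal enveloping algebra `u(L)` of a restricted Lie algebra `L`: the
quotient of the universal enveloping algebra by the two-sided ideal generated by the elements
`x ^ p - x^[p]` with `x` in `L`. -/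
def RestrictedEnvelopingAlgebra (F : Type*) (p : ℕ) (L : Type*) [Field F] [LieRing L]
    [LieAlgebra F L] [RestrictedLieAlgebra F p L] : Type _ :=
  RingQuot (RestrictedEnvelopingAlgebra.Rel F p L)

namespace RestrictedEnvelopingAlgebra

variable (F : Type*) (p : ℕ) (L : Type*) [Field F] [LieRing L] [LieAlgebra F L]
  [RestrictedLieAlgebra F p L]

instance : Ring (RestrictedEnvelopingAlgebra F p L) :=
  inferInstanceAs (Ring (RingQuot (RestrictedEnvelopingAlgebra.Rel F p L)))

instance : Algebra F (RestrictedEnvelopingAlgebra F p L) :=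
  inferInstanceAs (Algebra F (RingQuot (RestrictedEnvelopingAlgebra.Rel F p L)))

/-- The quotient map from the universal enveloping algebra to `u(L)`. -/
def mkAlgHom : UniversalEnvelopingAlgebra F L →ₐ[F] RestrictedEnvelopingAlgebra F p L :=
  RingQuot.mkAlgHom F (RestrictedEnvelopingAlgebra.Rel F p L)

variable {L} in
/-- The canonical map from `L` to `u(L)`. -/
def of (x : L) : RestrictedEnvelopingAlgebra F p L :=
  mkAlgHom F p L (UniversalEnvelopingAlgebra.ι F x)

end RestrictedEnvelopingAlgebra

namespace IsRestrictedModule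

variable {F : Type*} {p : ℕ} {L M : Type*} [Field F] [LieRing L] [LieAlgebra F L]
  [RestrictedLieAlgebra F p L] [AddCommGroup M] [Module F M] [LieRingModule L M] [LieModule F L M]

/-- The representation of `u(L)` on a restricted `L`-module. -/
def toEnd (h : IsRestrictedModule F p L M) :
    RestrictedEnvelopingAlgebra F p L →ₐ[F] Module.End F M :=
  RingQuot.liftAlgHom F ⟨UniversalEnvelopingAlgebra.lift F (LieModule.toEnd F L M), by
    rintro _ _ ⟨x⟩
    rw [map_pow, UniversalEnvelopingAlgebra.lift_ι_apply,
      UniversalEnvelopingAlgebra.lift_ι_apply]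
    exact (h x).symm⟩

/-- A restricted `L`-module, regarded as a `u(L)`-module. -/
@[nolint unusedArguments]
def AsModule (_h : IsRestrictedModule F p L M) : Type _ := M

instance (h : IsRestrictedModule F p L M) : AddCommGroup h.AsModule :=
  inferInstanceAs (AddCommGroup M)

instance (h : IsRestrictedModule F p L M) : Module (RestrictedEnvelopingAlgebra F p L) h.AsModule :=
  Module.compHom M h.toEnd.toRingHom

/-- The identity map from a restricted `L`-module to the associated `u(L)`-module. -/
def toAsModule (h : IsRestrictedModule F p L M) : M ≃+ h.AsModule := AddEquiv.refl M

theorem of_smul (h : IsRestrictedModule F p L M) (x : L) (m : M) :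
    RestrictedEnvelopingAlgebra.of F p x • h.toAsModule m = h.toAsModule ⁅x, m⁆ := by
  change h.toEnd (RestrictedEnvelopingAlgebra.of F p x) m = ⁅x, m⁆
  have : h.toEnd (RestrictedEnvelopingAlgebra.of F p x) = LieModule.toEnd F L M x := by
    rw [← UniversalEnvelopingAlgebra.lift_ι_apply F (LieModule.toEnd F L M) x]
    exact RingQuot.liftAlgHom_mkAlgHom_apply F _ _ _
  rw [this, LieModule.toEnd_apply_apply]

end IsRestrictedModule

/-- The one-dimensional trivial module of a restricted Lie algebra is restricted. -/
theorem isRestrictedModule_trivial (F : Type*) (p : ℕ) [Fact p.Prime] (L : Type*) [Field F]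
    [LieRing L] [LieAlgebra F L] [RestrictedLieAlgebra F p L] :
    IsRestrictedModule F p L (TrivialLieModule F L F) := by
  have key : ∀ y : L, LieModule.toEnd F L (TrivialLieModule F L F) y = 0 := fun y => by
    refine LinearMap.ext fun m => ?_
    exact trivial_lie_zero L (TrivialLieModule F L F) y m
  intro x
  rw [key, key, zero_pow (Fact.out : p.Prime).ne_zero]

/-! ## Loewy layers, projective covers and composition multiplicities -/

/-- The Loewy series of an `A`-module `M`, numbered from `0`: its `n`-th term is `Jac(A) ^ n M`. -/
def loewySeries (A M : Type*) [Ring A] [AddCommGroup M] [Module A M] : ℕ → Submodule A M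
  | 0 => ⊤
  | n + 1 => Ring.jacobson A • loewySeries A M n

/-- The second Loewy layer `Jac(A) M / Jac(A) ^ 2 M` of an `A`-module `M`. -/
abbrev SecondLoewyLayer (A M : Type*) [Ring A] [AddCommGroup M] [Module A M] : Type _ :=
  loewySeries A M 1 ⧸ (loewySeries A M 2).submoduleOf (loewySeries A M 1)

/-- A homomorphism `π : P → M` exhibits `P` as a projective cover of `M` if `P` is projective, `π`
is surjective, and the kernel of `π` is contained in `Jac(A) P`. -/
structure IsProjectiveCover {A P M : Type*} [Ring A] [AddCommGroup P] [Module A P]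
    [AddCommGroup M] [Module A M] (π : P →ₗ[A] M) : Prop where
  projective : Module.Projective A P
  surjective : Function.Surjective π
  ker_le : LinearMap.ker π ≤ Ring.jacobson A • (⊤ : Submodule A P)

/-- The number of factors of a composition series of a module that are isomorphic to `S`. -/
def compositionMultiplicity {A M : Type*} [Ring A] [AddCommGroup M] [Module A M]
    (s : CompositionSeries (Submodule A M)) (S : Type*) [AddCommGroup S] [Module A S] : ℕ :=
  Nat.card {i : Fin s.length //
    Nonempty ((s i.succ ⧸ (s i.castSucc).submoduleOf (s i.succ)) ≃ₗ[A] S)}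

/-! ## Split abelian chief factors -/

section ChiefFactors

variable {F L : Type*} [Field F] [LieRing L] [LieAlgebra F L]

/-- For ideals `I ≤ J` of `L`, the canonical homomorphism of Lie algebras `L / I → L / J`. -/
def LieIdeal.quotientFactor {I J : LieIdeal F L} (h : I ≤ J) : (L ⧸ I) →ₗ⁅F⁆ (L ⧸ J) :=
  { Submodule.factor (p := I.toSubmodule) (p' := J.toSubmodule) h with
    map_lie' := by
      rintro ⟨x⟩ ⟨y⟩
      rfl }

/-- For ideals `I ≤ J` of `L`, the exact sequence `0 → J / I → L / I → L / J → 0` splits in the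
category of Lie algebras, i.e. `L / I → L / J` has a section that is a homomorphism of Lie
algebras. -/
def IsSplitFactor {I J : LieIdeal F L} (h : I ≤ J) : Prop :=
  ∃ σ : (L ⧸ J) →ₗ⁅F⁆ (L ⧸ I), ∀ z : L ⧸ J, LieIdeal.quotientFactor h (σ z) = z

/-- For ideals `I ≤ J` of `L`, the factor `J / I` is an abelian Lie algebra. -/
def IsAbelianFactor (I J : LieIdeal F L) : Prop :=
  IsLieAbelian (J ⧸ LieIdeal.comap J.incl I)

/-- For ideals `I ≤ J` of `L`, the `L`-module `J / I` is isomorphic to `S`. -/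
def IsFactorIsoTo (I J : LieIdeal F L) (S : Type*) [AddCommGroup S] [Module F S]
    [LieRingModule L S] [LieModule F L S] : Prop :=
  Nonempty ((J ⧸ LieSubmodule.comap (LieSubmodule.incl J) I) ≃ₗ⁅F,L⁆ S)

/-- A chief series of `L` is a composition series from `0` to `L` in the lattice of ideals of
`L`: an ascending chain `0 = L_0 ⊂ L_1 ⊂ ⋯ ⊂ L_n = L` of ideals in which no ideal lies strictly
between two consecutive terms. -/
structure ChiefSeries (F L : Type*) [Field F] [LieRing L] [LieAlgebra F L] where
  /-- The chain of ideals. -/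
  series : CompositionSeries (LieIdeal F L)
  head_eq : series.head = ⊥
  last_eq : series.last = ⊤

/-- The number of abelian chief factors `L_j / L_{j-1}` of a given chief series that are isomorphic
to `S` as an `L`-module and for which `0 → L_j / L_{j-1} → L / L_{j-1} → L / L_j → 0` splits in the
category of Lie algebras. -/
def ChiefSeries.splitMultiplicity (c : ChiefSeries F L) (S : Type*) [AddCommGroup S] [Module F S]
    [LieRingModule L S] [LieModule F L S] : ℕ :=
  Nat.card {j : Fin c.series.length //
    IsAbelianFactor (c.series j.castSucc) (c.series j.succ) ∧
    IsFactorIsoTo (c.series j.castSucc) (c.series j.succ) S ∧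
    IsSplitFactor (c.series.lt_succ j).le}

theorem ChiefSeries.nonempty [FiniteDimensional F L] : Nonempty (ChiefSeries F L) := by
  have : WellFoundedLT (LieIdeal F L) :=
    LieSubmodule.wellFoundedLT_of_isArtinian F L L
  have : WellFoundedGT (LieIdeal F L) :=
    LieSubmodule.wellFoundedGT_of_noetherian F L L
  obtain ⟨f, f0, n, hn⟩ := exists_covBy_seq_of_wellFoundedLT_wellFoundedGT (LieIdeal F L)
  exact ⟨⟨⟨n, fun i ↦ f i, fun i ↦ hn.2 i i.2⟩, f0.eq_bot, hn.1.eq_top⟩⟩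

end ChiefFactors

/-- The `F`-subspace `⟨L^[p]⟩` of `L` spanned by the elements `x^[p]` with `x` in `L`. -/
def pMapSpan (F : Type*) (p : ℕ) (L : Type*) [Field F] [LieRing L] [LieAlgebra F L]
    [RestrictedLieAlgebra F p L] : Submodule F L :=
  Submodule.span F (Set.range (pMap F p : L → L))

/-- The derived algebra `[L, L]`, as a subspace of `L`. -/
def derivedSubspace (F L : Type*) [Field F] [LieRing L] [LieAlgebra F L] : Submodule F L :=
  (⁅(⊤ : LieIdeal F L), (⊤ : LieIdeal F L)⁆ : LieIdeal F L).toSubmodule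

end

/-! The multiplicity of `S` is read off from homomorphisms into `S`. Write `A` for the restricted
enveloping algebra. The second Loewy layer is semisimple, so the dimension of its homomorphisms to
`S` is the multiplicity times the dimension of the endomorphism space of `S`
(`finrank_hom_eq_mul_compositionMultiplicity`). Since the radical kills `S`, these homomorphisms are
the same as those from `J P`.

Let `m` in `P` map to `1`. A homomorphism `f : J P → S` gives the derivation `x ↦ f (x m)`, which is
restricted because `x ^ p = x^[p]` in `A`. This assignment is injective, and its image is a
complement of the inner derivations in the restricted ones
(`finrank_hom_add_finrank_lieCoboundaries`): nothing nonzero is inner because `J` kills `S`, and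
everything is reached because a restricted derivation defines a restricted extension of the trivial
module by `S`, to which the projective module `P` maps. Thus homomorphisms from `J P` to `S` compute
restricted first cohomology.

Ordinary first cohomology is computed by `finrank_lieCocycles_eq`. Filter the derivations by the
ideals of a chief series on which they vanish, and add the inner ones at each stage. The dimension
drops by that of the endomorphism space exactly at the split factors isomorphic to `S`.

It remains to compare the two cohomologies. If `S` is nontrivial, it has no invariants; as `d
(x^[p]) - x ^ (p - 1) d x` is always invariant, every derivation is restricted
(`lieCocycles_le_restrictedCocycles`). If `S` is trivial, derivations are the linear maps killing
`[L, L]`, and restricted ones also kill the span of the `p`-th powers; this accounts for the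
correction term (`finrank_lieCocycles_eq_restrictedCocycles_add`). -/

open RestrictedLieAlgebra (pMap)

section EnvelopingAlgebra

attribute [local instance] LieRing.ofAssociativeRing

/-! ### A finiteness criterion for filtered algebras -/

section FilteredFinite

variable {F A κ : Type*} [Field F] [Ring A] [Algebra F A]

theorem prod_map_mem_pow (b : κ → A) {V : Submodule F A} (hb : ∀ k, b k ∈ V) (l : List κ) :
    (l.map b).prod ∈ V ^ l.length := by
  induction l with
  | nil => simpa using Submodule.one_le.mp (le_refl (1 : Submodule F A))
  | cons a l ih =>
    rw [List.map_cons, List.prod_cons, List.length_cons, pow_succ']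
    exact Submodule.mul_mem_mul (hb a) ih

/-- Modulo shorter products, the factors of a product may be permuted if their commutators are
again combinations of factors. -/
theorem prod_map_sub_mem_pow_of_perm (b : κ → A) {V : Submodule F A} (hb : ∀ k, b k ∈ V)
    (hcomm : ∀ i j, b i * b j - b j * b i ∈ V) {l l' : List κ} (h : l.Perm l') :
    (l.map b).prod - (l'.map b).prod ∈ V ^ (l.length - 1) := by
  induction h with
  | nil => simp
  | @cons a l l' h ih =>
    rw [List.map_cons, List.prod_cons, List.map_cons, List.prod_cons, ← mul_sub]
    rcases l with _ | ⟨c, l⟩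
    · have := h.nil_eq
      subst this
      simp
    · simp only [List.length_cons, Nat.add_sub_cancel] at ih ⊢
      rw [pow_succ']
      exact Submodule.mul_mem_mul (hb a) ih
  | swap x y l =>
    have : ((y :: x :: l).map b).prod - ((x :: y :: l).map b).prod =
        (b y * b x - b x * b y) * (l.map b).prod := by
      simp only [List.map_cons, List.prod_cons]
      noncomm_ring
    rw [this]
    simp only [List.length_cons, Nat.add_sub_cancel]
    rw [pow_succ']
    exact Submodule.mul_mem_mul (hcomm y x) (prod_map_mem_pow b hb l)
  | trans h₁ h₂ ih₁ ih₂ =>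
    rw [← h₁.length_eq] at ih₂
    simpa using add_mem ih₁ ih₂

theorem span_range_pow_le_span_lists (b : κ → A) (n : ℕ) :
    Submodule.span F (Set.range b) ^ n ≤
      Submodule.span F {a | ∃ l : List κ, l.length = n ∧ (l.map b).prod = a} := by
  induction n with
  | zero =>
    rw [pow_zero, Submodule.one_le]
    exact Submodule.subset_span ⟨[], rfl, rfl⟩
  | succ n ih =>
    rw [pow_succ']
    refine (mul_le_mul_right ih _).trans ?_
    rw [Submodule.span_mul_span, Submodule.span_le]
    rintro _ ⟨_, ⟨k, rfl⟩, _, ⟨l, hl, rfl⟩, rfl⟩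
    exact Submodule.subset_span ⟨k :: l, by simp [hl], by simp⟩

/-- An algebra generated by a finite set whose span contains `1`, the commutators and the `p`-th
powers of the elements of the set is finite-dimensional. -/
theorem finiteDimensional_of_commutator_pow_mem [Fintype κ] (b : κ → A) {p : ℕ} (hp : 2 ≤ p)
    (h_one : (1 : A) ∈ Submodule.span F (Set.range b))
    (hcomm : ∀ i j, b i * b j - b j * b i ∈ Submodule.span F (Set.range b))
    (hpow : ∀ i, b i ^ p ∈ Submodule.span F (Set.range b))
    (hgen : Algebra.adjoin F (Set.range b) = ⊤) : FiniteDimensional F A := by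
  classical
  set V := Submodule.span F (Set.range b) with hV
  have hb : ∀ k, b k ∈ V := fun k => Submodule.subset_span ⟨k, rfl⟩
  have h1V : 1 ≤ V := Submodule.one_le.mpr h_one
  have mono : ∀ {m n : ℕ}, m ≤ n → V ^ m ≤ V ^ n := fun h => pow_le_pow_right' h1V h
  -- The largest length of a word in which every generator occurs fewer than `p` times. In a longer
  -- word some generator occurs `p` times; moving these copies to the front costs only shorter
  -- words, and their product collapses into `V`.
  set N := Fintype.card κ * (p - 1) with hN
  have key : V ^ (N + 1) ≤ V ^ N := by
    refine (span_range_pow_le_span_lists b (N + 1)).trans (Submodule.span_le.mpr ?_)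
    rintro _ ⟨l, hl, rfl⟩
    obtain ⟨k, hk⟩ : ∃ k, p ≤ l.count k := by
      by_contra! hc
      have h1 : ∑ k, l.count k = l.length := by
        have := Multiset.sum_count_eq_card (s := Finset.univ) (m := (l : Multiset κ))
          (fun _ _ => Finset.mem_univ _)
        simpa using this
      have h2 : ∑ k, l.count k ≤ ∑ _k : κ, (p - 1) :=
        Finset.sum_le_sum fun k _ => Nat.le_sub_one_of_lt (hc k)
      rw [Finset.sum_const, smul_eq_mul, Finset.card_univ] at h2
      omega
    have hsub : (List.replicate p k).Subperm l :=
      (List.replicate_sublist_iff.mpr hk).subperm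
    obtain ⟨r, hr⟩ : ∃ r, l.Perm (List.replicate p k ++ r) := by
      exact ⟨_, (List.subperm_append_diff_self_of_count_le (fun x hx => by
        rw [List.eq_of_mem_replicate hx, List.count_replicate_self]; exact hk)).symm⟩
    have hlen : p + r.length = N + 1 := by
      have := hr.length_eq
      simp at this
      omega
    have h1 := prod_map_sub_mem_pow_of_perm b hb hcomm hr
    rw [hl, Nat.add_sub_cancel] at h1
    have h2 : ((List.replicate p k ++ r).map b).prod ∈ V ^ N := by
      rw [List.map_append, List.prod_append, List.map_replicate, List.prod_replicate]
      -- Replacing `p ≥ 2` factors by one shortens the word, from length `N + 1` to at most `N`.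
      refine mono (show r.length + 1 ≤ N by omega) ?_
      rw [pow_succ']
      exact Submodule.mul_mem_mul (hpow k) (prod_map_mem_pow b hb r)
    simpa using add_mem h1 h2
  have htop : V ^ N = ⊤ := by
    rw [eq_top_iff]
    -- By `key` the space `V ^ N` is a left ideal, and it contains `1`.
    have hmem : ∀ a ∈ Algebra.adjoin F (Set.range b), ∀ v ∈ V ^ N, a * v ∈ V ^ N := by
      intro a ha
      induction ha using Algebra.adjoin_induction with
      | mem x hx =>
        intro v hv
        refine key ?_
        rw [pow_succ']
        exact Submodule.mul_mem_mul (Submodule.subset_span hx) hv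
      | algebraMap c =>
        intro v hv
        rw [← Algebra.smul_def]
        exact Submodule.smul_mem _ _ hv
      | add x y _ _ hx hy =>
        intro v hv
        rw [add_mul]
        exact add_mem (hx v hv) (hy v hv)
      | mul x y _ _ hx hy =>
        intro v hv
        rw [mul_assoc]
        exact hx _ (hy v hv)
    intro a _
    have h1N : (1 : A) ∈ V ^ N := mono (Nat.zero_le N) (by
      simpa using Submodule.one_le.mp (le_refl (1 : Submodule F A)))
    simpa using hmem a (hgen ▸ Algebra.mem_top) 1 h1N
  have hfg : (V ^ N).FG := by
    refine Submodule.FG.pow ?_ N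
    exact Submodule.fg_span (Set.finite_range b)
  exact Module.finite_def.mpr (htop ▸ hfg)

end FilteredFinite

/-! ### Universal property and finite-dimensionality of the restricted enveloping algebra -/

namespace RestrictedEnvelopingAlgebra

variable (F : Type*) (p : ℕ) {L : Type*} [Field F] [LieRing L] [LieAlgebra F L]
  [RestrictedLieAlgebra F p L]

/-- The canonical map from `L` to `u(L)`, as a linear map. -/
noncomputable def ofLinear : L →ₗ[F] RestrictedEnvelopingAlgebra F p L :=
  (mkAlgHom F p L).toLinearMap ∘ₗ (UniversalEnvelopingAlgebra.ι F : L →ₗ⁅F⁆ _).toLinearMap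

theorem ofLinear_apply (x : L) : ofLinear F p x = of F p x := rfl

theorem of_lie (x y : L) : of F p ⁅x, y⁆ = of F p x * of F p y - of F p y * of F p x := by
  rw [of, LieHom.map_lie, LieRing.of_associative_ring_bracket, map_sub, map_mul, map_mul]
  rfl

theorem of_pow (x : L) : of F p x ^ p = of F p (pMap F p x) := by
  rw [of, ← map_pow]
  exact RingQuot.mkAlgHom_rel F (Rel.of x)

variable {F p}

/-- The universal property of `u(L)`. -/
noncomputable def lift {B : Type*} [Ring B] [Algebra F B] (ρ : L →ₗ⁅F⁆ B)
    (h : ∀ x, ρ (pMap F p x) = ρ x ^ p) : RestrictedEnvelopingAlgebra F p L →ₐ[F] B :=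
  RingQuot.liftAlgHom F ⟨UniversalEnvelopingAlgebra.lift F ρ, by
    rintro _ _ ⟨x⟩
    rw [map_pow, UniversalEnvelopingAlgebra.lift_ι_apply,
      UniversalEnvelopingAlgebra.lift_ι_apply, h]⟩

theorem lift_of {B : Type*} [Ring B] [Algebra F B] (ρ : L →ₗ⁅F⁆ B)
    (h : ∀ x, ρ (pMap F p x) = ρ x ^ p) (x : L) : lift ρ h (of F p x) = ρ x := by
  rw [← UniversalEnvelopingAlgebra.lift_ι_apply F ρ x]
  exact RingQuot.liftAlgHom_mkAlgHom_apply F _ _ _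

variable (F p L)

/-- The surjection from the universal enveloping algebra factors through the generated subalgebra,
by the universal property applied to `L → B`. -/
theorem adjoin_range_of :
    Algebra.adjoin F (Set.range (of F p : L → RestrictedEnvelopingAlgebra F p L)) = ⊤ := by
  set B := Algebra.adjoin F (Set.range (of F p : L → RestrictedEnvelopingAlgebra F p L))
  have hB : ∀ x : L, of F p x ∈ B := fun x => Algebra.subset_adjoin ⟨x, rfl⟩
  let g : L →ₗ⁅F⁆ B :=
    { (ofLinear F p).codRestrict (Subalgebra.toSubmodule B) hB with
      map_lie' := by
        intro x y
        exact Subtype.ext (of_lie F p x y) }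
  have hsurj : Function.Surjective (mkAlgHom F p L) := RingQuot.mkAlgHom_surjective F _
  have hcomp : B.val.comp (UniversalEnvelopingAlgebra.lift F g) = mkAlgHom F p L := by
    apply UniversalEnvelopingAlgebra.hom_ext
    ext x
    change ((UniversalEnvelopingAlgebra.lift F g (UniversalEnvelopingAlgebra.ι F x) : B) :
      RestrictedEnvelopingAlgebra F p L) = of F p x
    rw [UniversalEnvelopingAlgebra.lift_ι_apply]
    rfl
  rw [eq_top_iff]
  intro a _
  obtain ⟨b, rfl⟩ := hsurj a
  rw [← hcomp]
  exact (UniversalEnvelopingAlgebra.lift F g b).2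

instance [Fact p.Prime] [FiniteDimensional F L] :
    FiniteDimensional F (RestrictedEnvelopingAlgebra F p L) := by
  let B := Module.finBasis F L
  -- A basis of `L` together with `1`, so that powers of the span increase. Only spanning is needed,
  -- so no independence statement of Poincaré–Birkhoff–Witt type enters.
  let b : Option (Fin (Module.finrank F L)) → RestrictedEnvelopingAlgebra F p L :=
    fun o => o.elim 1 fun i => of F p (B i)
  have hof : ∀ x : L, of F p x ∈ Submodule.span F (Set.range b) := by
    intro x
    rw [← ofLinear_apply, ← B.sum_repr x, map_sum]
    refine Submodule.sum_mem _ fun i _ => ?_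
    rw [map_smul]
    exact Submodule.smul_mem _ _ (Submodule.subset_span ⟨some i, rfl⟩)
  have h1 : (1 : RestrictedEnvelopingAlgebra F p L) ∈ Submodule.span F (Set.range b) :=
    Submodule.subset_span ⟨none, rfl⟩
  refine finiteDimensional_of_commutator_pow_mem (p := p) b (Fact.out : p.Prime).two_le h1 ?_ ?_ ?_
  · rintro (_ | i) (_ | j)
    · simp [b]
    · simp [b]
    · simp [b]
    · rw [show b (some i) * b (some j) - b (some j) * b (some i) = of F p ⁅B i, B j⁆ from
        (of_lie F p _ _).symm]
      exact hof _
  · rintro (_ | i)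
    · simpa [b] using h1
    · rw [show b (some i) ^ p = of F p (pMap F p (B i)) from of_pow F p _]
      exact hof _
  · rw [eq_top_iff, ← adjoin_range_of F p L]
    refine Algebra.adjoin_le ?_
    rintro _ ⟨x, rfl⟩
    exact (Algebra.span_le_adjoin F _) (hof x)

instance [Fact p.Prime] [FiniteDimensional F L] :
    IsArtinianRing (RestrictedEnvelopingAlgebra F p L) :=
  IsArtinianRing.of_finite F _

end RestrictedEnvelopingAlgebra

/-! ### Multiplicities in semisimple modules -/

section Counting

/-- If a sequence of numbers grows by `e` at the indices in `P` and is constant at the others, then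
its total growth is `e` times the number of indices in `P`. -/
theorem last_eq_zero_add_mul_card {R : Type*} [CommSemiring R] (e : R) {n : ℕ}
    (d : Fin (n + 1) → R) (P : Fin n → Prop) (h1 : ∀ j, P j → d j.succ = d j.castSucc + e)
    (h2 : ∀ j, ¬ P j → d j.succ = d j.castSucc) :
    d (Fin.last n) = d 0 + e * Nat.card {j // P j} := by
  classical
  have h3 : ∀ j, d j.succ = d j.castSucc + if P j then e else 0 := fun j => by
    by_cases hj : P j
    · simp [hj, h1 j hj]
    · simp [hj, h2 j hj]
  have h4 : ∀ m (hm : m ≤ n), d ⟨m, by omega⟩ = d 0 +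
      ∑ j : Fin m, if P (Fin.castLE hm j) then e else 0 := by
    intro m
    induction m with
    | zero => intro _; simp
    | succ m ih =>
      intro hm
      rw [Fin.sum_univ_castSucc, ← add_assoc]
      have := ih (by omega)
      have h5 := h3 ⟨m, by omega⟩
      simp only [Fin.succ_mk, Fin.castSucc_mk] at h5
      rw [h5, this]
      rfl
  have h5 := h4 n le_rfl
  simp only [Fin.castLE_rfl, id] at h5
  rw [show Fin.last n = ⟨n, by omega⟩ from rfl, h5, Nat.card_eq_fintype_card,
    Fintype.card_subtype, Finset.sum_ite, Finset.sum_const_zero, Finset.sum_const, nsmul_eq_mul,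
    add_zero, mul_comm]

end Counting

section Hom

variable {F A S : Type*} [Field F] [Ring A] [AddCommGroup S] [Module A S] [Module F S]
  [SMulCommClass A F S]

theorem finrank_hom_simple_of_iso {Q : Type*} [AddCommGroup Q] [Module A Q]
    [Module.Finite F (S →ₗ[A] S)] (h : Nonempty (Q ≃ₗ[A] S)) :
    Module.Finite F (Q →ₗ[A] S) ∧ Module.finrank F (Q →ₗ[A] S) = Module.finrank F (S →ₗ[A] S) := by
  obtain ⟨e⟩ := h
  let E : (Q →ₗ[A] S) ≃ₗ[F] (S →ₗ[A] S) := e.congrLeft S F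
  exact ⟨Module.Finite.equiv E.symm, E.finrank_eq⟩

theorem finrank_hom_simple_of_not_iso {Q : Type*} [AddCommGroup Q] [Module A Q]
    [IsSimpleModule A Q] [IsSimpleModule A S] (h : ¬ Nonempty (Q ≃ₗ[A] S)) :
    Module.Finite F (Q →ₗ[A] S) ∧ Module.finrank F (Q →ₗ[A] S) = 0 := by
  have : Subsingleton (Q →ₗ[A] S) := by
    refine subsingleton_of_forall_eq 0 fun f => ?_
    by_contra hf
    exact h ⟨LinearEquiv.ofBijective f ((LinearMap.bijective_or_eq_zero f).resolve_right hf)⟩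
  exact ⟨inferInstance, Module.finrank_zero_of_subsingleton⟩

theorem exists_hom_equiv_prod {M : Type*} [AddCommGroup M] [Module A M] [IsSemisimpleModule A M]
    (K : Submodule A M) :
    Nonempty ((M →ₗ[A] S) ≃ₗ[F] (K →ₗ[A] S) × ((M ⧸ K) →ₗ[A] S)) := by
  obtain ⟨C, hC⟩ := exists_isCompl K
  let e : (K × (M ⧸ K)) ≃ₗ[A] M :=
    (LinearEquiv.prodCongr (LinearEquiv.refl A K) (Submodule.quotientEquivOfIsCompl K C hC)).trans
      (Submodule.prodEquivOfIsCompl K C hC)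
  exact ⟨(e.congrLeft S F).symm.trans (LinearMap.coprodEquiv F).symm⟩

variable (F)

/-- The multiplicity of a simple module `S` in a semisimple module is computed by homomorphisms
to `S`. -/
theorem finrank_hom_eq_mul_compositionMultiplicity {M : Type*} [AddCommGroup M] [Module A M]
    [IsSemisimpleModule A M] [IsSimpleModule A S] [Module.Finite F (S →ₗ[A] S)]
    (s : CompositionSeries (Submodule A M)) (h0 : s.head = ⊥) (h1 : s.last = ⊤) :
    Module.finrank F (M →ₗ[A] S) =
      Module.finrank F (S →ₗ[A] S) * compositionMultiplicity s S := by
  -- Semisimplicity splits each step of the series, and Schur's lemma evaluates the contribution of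
  -- the factor. Finiteness is carried along because `finrank` is additive only for finite modules.
  have step : ∀ j : Fin s.length, Module.Finite F (s j.castSucc →ₗ[A] S) →
      Module.Finite F (s j.succ →ₗ[A] S) ∧
      (Nonempty ((s j.succ ⧸ (s j.castSucc).submoduleOf (s j.succ)) ≃ₗ[A] S) →
        Module.finrank F (s j.succ →ₗ[A] S) =
          Module.finrank F (s j.castSucc →ₗ[A] S) + Module.finrank F (S →ₗ[A] S)) ∧
      (¬ Nonempty ((s j.succ ⧸ (s j.castSucc).submoduleOf (s j.succ)) ≃ₗ[A] S) →
        Module.finrank F (s j.succ →ₗ[A] S) = Module.finrank F (s j.castSucc →ₗ[A] S)) := by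
    intro j hfin
    have hcov : s j.castSucc ⋖ s j.succ := s.step j
    have hsimple : IsSimpleModule A (s j.succ ⧸ (s j.castSucc).submoduleOf (s j.succ)) :=
      (covBy_iff_quot_is_simple hcov.le).mp hcov
    obtain ⟨E⟩ := exists_hom_equiv_prod (F := F) (S := S) ((s j.castSucc).submoduleOf (s j.succ))
    let E1 : ((s j.castSucc).submoduleOf (s j.succ) →ₗ[A] S) ≃ₗ[F] (s j.castSucc →ₗ[A] S) :=
      (Submodule.submoduleOfEquivOfLe hcov.le).congrLeft S F
    have hfin1 := Module.Finite.equiv E1.symm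
    by_cases hiso : Nonempty ((s j.succ ⧸ (s j.castSucc).submoduleOf (s j.succ)) ≃ₗ[A] S)
    · obtain ⟨hfin2, hr⟩ := finrank_hom_simple_of_iso (F := F) hiso
      refine ⟨Module.Finite.equiv E.symm, fun _ => ?_, fun h => absurd hiso h⟩
      rw [E.finrank_eq, Module.finrank_prod, E1.finrank_eq, hr]
    · obtain ⟨hfin2, hr⟩ := finrank_hom_simple_of_not_iso (F := F) hiso
      refine ⟨Module.Finite.equiv E.symm, fun h => absurd h hiso, fun _ => ?_⟩
      rw [E.finrank_eq, Module.finrank_prod, E1.finrank_eq, hr, add_zero]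
  have hsub : Subsingleton (s 0 →ₗ[A] S) := by
    have hs : s 0 = ⊥ := h0
    rw [hs]
    infer_instance
  have hfin : ∀ j : Fin (s.length + 1), Module.Finite F (s j →ₗ[A] S) := by
    intro j
    induction j using Fin.induction with
    | zero => infer_instance
    | succ j ih => exact (step j ih).1
  have := last_eq_zero_add_mul_card (Module.finrank F (S →ₗ[A] S))
    (fun j => Module.finrank F (s j →ₗ[A] S)) _ (fun j => (step j (hfin _)).2.1)
    (fun j => (step j (hfin _)).2.2)
  rw [show Module.finrank F (s 0 →ₗ[A] S) = 0 from Module.finrank_zero_of_subsingleton,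
    zero_add, Nat.cast_id] at this
  rw [compositionMultiplicity, ← this]
  have hl : s (Fin.last s.length) = ⊤ := h1
  let E : (M →ₗ[A] S) ≃ₗ[F] (s (Fin.last s.length) →ₗ[A] S) :=
    ((LinearEquiv.ofTop _ hl).congrLeft S F).symm
  exact E.finrank_eq

end Hom

/-! ### Commuting operators without common kernel -/

section CommutingOperators

/-- Let `I` be the ideal generated by the `t a`. If some element of `I` acts as the identity on `V`,
writing it as a combination of the `t a` and taking the same combination of the `d a` produces `s`,
by the symmetry `hd`. Such an element exists by Nakayama's lemma: the chain `I ^ n V` stabilizes, so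
some `r` with `r - 1` in `I` kills `I ^ n V`; then `I ^ n` kills `r V`, which forces `r V = 0`. -/
theorem exists_eq_smul_of_smul_comm {R V W : Type*} [CommRing R] [AddCommGroup V] [Module R V]
    [IsArtinian R V] [IsNoetherian R V] (t : W → R) (hker : ∀ v : V, (∀ a, t a • v = 0) → v = 0)
    (d : W → V) (hd : ∀ a b, t a • d b = t b • d a) : ∃ s, ∀ a, d a = t a • s := by
  let I : Ideal R := Ideal.span (Set.range t)
  have hI : ∀ a, t a ∈ I := fun a => Ideal.subset_span ⟨a, rfl⟩
  have hkill : ∀ n : ℕ, ∀ v : V, (∀ r ∈ I ^ n, r • v = 0) → v = 0 := by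
    intro n
    induction n with
    | zero =>
      intro v hv
      simpa using hv 1 (by simp)
    | succ n ih =>
      intro v hv
      refine hker v fun a => ih _ fun r hr => ?_
      rw [smul_smul]
      exact hv _ (by rw [pow_succ]; exact Ideal.mul_mem_mul hr (hI a))
  obtain ⟨n, hn⟩ := IsArtinian.monotone_stabilizes (R := R) (M := V)
    ⟨fun n => OrderDual.toDual (I ^ n • (⊤ : Submodule R V)), fun m n hmn =>
      Submodule.smul_mono_left (Ideal.pow_le_pow_right hmn)⟩
  have hn' : I ^ n • (⊤ : Submodule R V) ≤ I • (I ^ n • (⊤ : Submodule R V)) := by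
    have h1 : I ^ n • (⊤ : Submodule R V) = I ^ (n + 1) • (⊤ : Submodule R V) :=
      hn (n + 1) (by omega)
    rw [← Submodule.mul_smul, ← pow_succ', ← h1]
  obtain ⟨r, hr1, hr2⟩ := Submodule.exists_sub_one_mem_and_smul_eq_zero_of_fg_of_le_smul I _
    (IsNoetherian.noetherian _) hn'
  have hr : ∀ v : V, r • v = 0 := fun v => hkill n _ fun q hq => by
    rw [smul_smul, mul_comm, ← smul_smul]
    exact hr2 _ (Submodule.smul_mem_smul hq trivial)
  have hex : ∀ q ∈ I, ∃ s : V, ∀ b, t b • s = q • d b := by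
    intro q hq
    induction hq using Submodule.span_induction with
    | mem x hx =>
      obtain ⟨a, rfl⟩ := hx
      exact ⟨d a, fun b => hd b a⟩
    | zero => exact ⟨0, by simp⟩
    | add x y _ _ hx hy =>
      obtain ⟨s, hs⟩ := hx
      obtain ⟨s', hs'⟩ := hy
      exact ⟨s + s', fun b => by rw [smul_add, hs, hs', add_smul]⟩
    | smul c x _ hx =>
      obtain ⟨s, hs⟩ := hx
      exact ⟨c • s, fun b => by rw [smul_comm, hs, smul_smul, smul_eq_mul]⟩
  obtain ⟨s, hs⟩ := hex _ hr1
  -- The sign appears because `s` belongs to `r - 1`, which acts as `-1`.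
  refine ⟨-s, fun b => ?_⟩
  rw [smul_neg, hs, sub_smul, one_smul, hr, zero_sub, neg_neg]

open scoped IsMulCommutative in
/-- Let `T` be a family of commuting operators on a finite-dimensional space without non-zero
common kernel. Then every map `d` with `T a (d b) = T b (d a)` is of the form `a ↦ T a s`. -/
theorem exists_eq_apply_of_commute {F V W : Type*} [Field F] [AddCommGroup V] [Module F V]
    [FiniteDimensional F V] (T : W → Module.End F V)
    (hT : ∀ a b, T a * T b = T b * T a) (hker : ∀ v, (∀ a, T a v = 0) → v = 0)
    (d : W → V) (hd : ∀ a b, T a (d b) = T b (d a)) : ∃ s, ∀ a, d a = T a s := by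
  let R := Algebra.adjoin F (Set.range T)
  have : IsMulCommutative R := Algebra.isMulCommutative_adjoin F (by
    rintro _ ⟨a, rfl⟩ _ ⟨b, rfl⟩
    exact hT a b)
  have hart : IsArtinian R V := isArtinian_of_tower F inferInstance
  have hnoe : IsNoetherian R V := isNoetherian_of_tower F inferInstance
  exact exists_eq_smul_of_smul_comm (R := R) (V := V)
    (fun a => ⟨T a, Algebra.subset_adjoin ⟨a, rfl⟩⟩) hker d hd

end CommutingOperators

/-! ### Derivations of a solvable Lie algebra and split chief factors -/

section Derivations

variable (F L S : Type*) [Field F] [LieRing L] [LieAlgebra F L] [AddCommGroup S] [Module F S]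
  [LieRingModule L S] [LieModule F L S]

/-- The derivations of a Lie algebra `L` with values in an `L`-module, i.e. the 1-cocycles. -/
def lieCocycles : Submodule F (L →ₗ[F] S) where
  carrier := {d | ∀ x y, d ⁅x, y⁆ = ⁅x, d y⁆ - ⁅y, d x⁆}
  add_mem' := by
    intro d d' h h' x y
    simp only [LinearMap.add_apply, lie_add, h x y, h' x y]
    abel
  zero_mem' := by
    intro x y
    simp
  smul_mem' := by
    intro c d h x y
    simp only [LinearMap.smul_apply, lie_smul, h x y, smul_sub]

/-- The inner derivations with values in an `L`-module, i.e. the 1-coboundaries. -/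
def lieCoboundaries : Submodule F (L →ₗ[F] S) :=
  LinearMap.range ((LieModule.toEnd F L S).toLinearMap.flip)

variable {F L S}

theorem mem_lieCoboundaries {d : L →ₗ[F] S} :
    d ∈ lieCoboundaries F L S ↔ ∃ s : S, ∀ x, d x = ⁅x, s⁆ := by
  constructor
  · rintro ⟨s, rfl⟩
    exact ⟨s, fun x => rfl⟩
  · rintro ⟨s, h⟩
    exact ⟨s, LinearMap.ext fun x => (h x).symm⟩

theorem lieCoboundaries_le : lieCoboundaries F L S ≤ lieCocycles F L S := by
  intro d hd
  obtain ⟨s, hs⟩ := mem_lieCoboundaries.mp hd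
  intro x y
  rw [hs, hs, hs, lie_lie]

variable (S) in
/-- The derivations with values in an `L`-module that vanish on an ideal of `L`. -/
def lieCocyclesVanishing (I : LieIdeal F L) : Submodule F (L →ₗ[F] S) where
  carrier := {d | d ∈ lieCocycles F L S ∧ ∀ x ∈ I, d x = 0}
  add_mem' := by
    rintro d d' ⟨h, h0⟩ ⟨h', h0'⟩
    exact ⟨add_mem h h', fun x hx => by rw [LinearMap.add_apply, h0 x hx, h0' x hx, add_zero]⟩
  zero_mem' := ⟨zero_mem _, fun _ _ => rfl⟩
  smul_mem' := by
    rintro c d ⟨h, h0⟩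
    exact ⟨Submodule.smul_mem _ c h, fun x hx => by rw [LinearMap.smul_apply, h0 x hx, smul_zero]⟩

/-- The invariants of an ideal form a submodule, which by irreducibility is zero or everything. -/
theorem eq_zero_of_ideal_lie_eq_zero [LieModule.IsIrreducible F L S] {I : LieIdeal F L}
    (hI : ¬ ∀ x ∈ I, ∀ s : S, ⁅x, s⁆ = 0) {s : S} (hs : ∀ x ∈ I, ⁅x, s⁆ = 0) : s = 0 := by
  let N : LieSubmodule F L S :=
    { carrier := {s | ∀ x ∈ I, ⁅x, s⁆ = 0}
      add_mem' := fun {s t} h h' x hx => by rw [lie_add, h x hx, h' x hx, add_zero]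
      zero_mem' := fun x _ => lie_zero x
      smul_mem' := fun c s h x hx => by rw [lie_smul, h x hx, smul_zero]
      lie_mem := fun {y s} h x hx => by
        rw [leibniz_lie, h x hx, lie_zero, add_zero]
        exact h _ (lie_mem_left F L I x y hx) }
  rcases eq_bot_or_eq_top N with h | h
  · exact (LieSubmodule.mem_bot s).mp (h ▸ (show s ∈ N from hs))
  · refine absurd (fun x hx t => ?_) hI
    exact (show t ∈ N from h ▸ LieSubmodule.mem_top t) x hx

/-- Both `a` and `⁅a, x⁆` lie in the ideal, so only `⁅a, d x⁆` survives in the cocycle identity for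
`a` and `x`. -/
theorem ideal_lie_eq_zero_of_mem_lieCocyclesVanishing {I : LieIdeal F L} {d : L →ₗ[F] S}
    (hd : d ∈ lieCocyclesVanishing S I) (x : L) : ∀ a ∈ I, ⁅a, d x⁆ = 0 := by
  intro a ha
  have h := hd.1 a x
  rw [hd.2 _ (lie_mem_left F L I a x ha), hd.2 a ha, lie_zero, sub_zero] at h
  exact h.symm

theorem lieCocyclesVanishing_eq_bot [LieModule.IsIrreducible F L S] {I : LieIdeal F L}
    (hI : ¬ ∀ x ∈ I, ∀ s : S, ⁅x, s⁆ = 0) : lieCocyclesVanishing S I = ⊥ := by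
  rw [eq_bot_iff]
  intro d hd
  refine LinearMap.ext fun x => ?_
  exact eq_zero_of_ideal_lie_eq_zero hI (ideal_lie_eq_zero_of_mem_lieCocyclesVanishing hd x)

theorem lieCocyclesVanishing_mono {I J : LieIdeal F L} (h : I ≤ J) :
    lieCocyclesVanishing S J ≤ lieCocyclesVanishing S I :=
  fun _ hd => ⟨hd.1, fun x hx => hd.2 x (h hx)⟩

theorem lieCoboundaries_le_lieCocyclesVanishing {I : LieIdeal F L}
    (hI : ∀ x ∈ I, ∀ s : S, ⁅x, s⁆ = 0) : lieCoboundaries F L S ≤ lieCocyclesVanishing S I := by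
  intro d hd
  obtain ⟨s, hs⟩ := mem_lieCoboundaries.mp hd
  exact ⟨lieCoboundaries_le hd, fun x hx => by rw [hs, hI x hx]⟩

/-- Chief factors of a solvable Lie algebra are abelian. -/
theorem lie_le_of_covBy [LieAlgebra.IsSolvable L] {B A : LieIdeal F L} (h : B ⋖ A) :
    ⁅A, A⁆ ≤ B := by
  by_contra hAB
  -- Otherwise `A = [A, A] + B`; iterating, `A` is the sum of `B` and any term of its derived
  -- series, which eventually vanishes.
  have htop : A ≤ ⁅A, A⁆ ⊔ B := by
    rcases h.eq_or_eq (c := ⁅A, A⁆ ⊔ B) le_sup_right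
      (sup_le (LieSubmodule.lie_le_right _ _) h.le) with h' | h'
    · exact absurd (le_sup_left.trans h'.le) hAB
    · exact h'.ge
  have hk : ∀ k, A ≤ LieAlgebra.derivedSeriesOfIdeal F L k A ⊔ B := by
    intro k
    induction k with
    | zero => exact le_sup_left
    | succ k ih =>
      refine htop.trans (sup_le ?_ le_sup_right)
      refine (LieSubmodule.mono_lie ih ih).trans ?_
      rw [LieAlgebra.derivedSeriesOfIdeal_succ, LieSubmodule.lie_sup, LieSubmodule.sup_lie]
      refine sup_le (sup_le_sup le_rfl (LieSubmodule.lie_le_left _ _)) ?_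
      exact (LieSubmodule.lie_le_right _ _).trans le_sup_right
  obtain ⟨k, hk0⟩ := LieAlgebra.IsSolvable.solvable F L
  have hA : LieAlgebra.derivedSeriesOfIdeal F L k A ≤ ⊥ := by
    rw [← hk0]
    exact LieAlgebra.derivedSeriesOfIdeal_mono le_top k
  exact h.lt.not_ge ((hk k).trans (sup_le (hA.trans bot_le) le_rfl))

/-- Since `[A, A] ≤ B` acts trivially, `A` acts on `S` by commuting operators, without common kernel
by irreducibility. As `d` vanishes on `[A, A]`, the cocycle identity on `A` is the symmetry required
by `exists_eq_apply_of_commute`, so `d` agrees on `A` with an inner derivation. The difference then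
takes values killed by `A`, hence is zero on all of `L`. -/
theorem lieCocyclesVanishing_le_lieCoboundaries [LieAlgebra.IsSolvable L] [FiniteDimensional F S]
    [LieModule.IsIrreducible F L S] {B A : LieIdeal F L} (h : B ⋖ A)
    (hB : ∀ x ∈ B, ∀ s : S, ⁅x, s⁆ = 0) (hA : ¬ ∀ x ∈ A, ∀ s : S, ⁅x, s⁆ = 0) :
    lieCocyclesVanishing S B ≤ lieCoboundaries F L S := by
  intro d hd
  have hAA : ∀ a b : A, ⁅(a : L), (b : L)⁆ ∈ B := fun a b =>
    lie_le_of_covBy h (LieSubmodule.lie_mem_lie a.2 b.2)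
  obtain ⟨s, hs⟩ := exists_eq_apply_of_commute (F := F) (V := S)
    (fun a : A => LieModule.toEnd F L S a)
    (by
      intro a b
      refine LinearMap.ext fun s => ?_
      have := hB _ (hAA a b) s
      rw [lie_lie, sub_eq_zero] at this
      exact this)
    (fun v hv => eq_zero_of_ideal_lie_eq_zero hA fun x hx => hv ⟨x, hx⟩)
    (fun a => d a)
    (by
      intro a b
      have h1 := hd.1 a b
      rw [hd.2 _ (hAA a b)] at h1
      exact (sub_eq_zero.mp h1.symm))
  refine mem_lieCoboundaries.mpr ⟨s, fun x => ?_⟩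
  rw [← sub_eq_zero]
  refine eq_zero_of_ideal_lie_eq_zero hA fun a ha => ?_
  have h1 := hd.1 a x
  have h2 := hs ⟨⁅a, x⁆, lie_mem_left F L A a x ha⟩
  have h3 := hs ⟨a, ha⟩
  simp only [LieModule.toEnd_apply_apply] at h2 h3
  rw [h2, h3, lie_lie, sub_left_inj] at h1
  rw [lie_sub, h1, sub_self]

/-! ### Chief factors -/

theorem isAbelianFactor_iff {B A : LieIdeal F L} :
    IsAbelianFactor B A ↔ ∀ a ∈ A, ∀ b ∈ A, ⁅a, b⁆ ∈ B := by
  constructor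
  · intro h a ha b hb
    have h1 : ⁅(LieSubmodule.Quotient.mk ⟨a, ha⟩ : A ⧸ LieIdeal.comap A.incl B),
        (LieSubmodule.Quotient.mk ⟨b, hb⟩ : A ⧸ LieIdeal.comap A.incl B)⁆ = 0 := h.trivial _ _
    rw [← LieSubmodule.Quotient.mk_bracket] at h1
    exact (LieSubmodule.Quotient.mk_eq_zero' (N := LieIdeal.comap A.incl B)).mp h1
  · intro h
    refine ⟨?_⟩
    rintro ⟨a⟩ ⟨b⟩
    exact (LieSubmodule.Quotient.mk_eq_zero' (N := LieIdeal.comap A.incl B)).mpr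
      (h a a.2 b b.2)

theorem isFactorIsoTo_iff {B A : LieIdeal F L} :
    IsFactorIsoTo B A S ↔
      ∃ f : A →ₗ⁅F,L⁆ S, Function.Surjective f ∧ ∀ a : A, f a = 0 ↔ (a : L) ∈ B := by
  constructor
  · rintro ⟨e⟩
    refine ⟨e.toLieModuleHom.comp (LieSubmodule.Quotient.mk' _),
      e.surjective.comp (LieSubmodule.Quotient.surjective_mk' _), fun a => ?_⟩
    have : e (LieSubmodule.Quotient.mk' (LieSubmodule.comap (LieSubmodule.incl A) B) a) = 0 ↔
        LieSubmodule.Quotient.mk' (LieSubmodule.comap (LieSubmodule.incl A) B) a = 0 :=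
      e.toLinearEquiv.map_eq_zero_iff
    exact this.trans (LieSubmodule.Quotient.mk_eq_zero _)
  · rintro ⟨f, hf, hker⟩
    have hk : LinearMap.ker (f : A →ₗ[F] S) =
        (LieSubmodule.comap (LieSubmodule.incl A) B).toSubmodule := by
      ext a
      exact hker a
    let e : (A ⧸ LieSubmodule.comap (LieSubmodule.incl A) B) ≃ₗ[F] S :=
      (Submodule.quotEquivOfEq _ _ hk.symm).trans
        ((f : A →ₗ[F] S).quotKerEquivOfSurjective hf)
    exact ⟨{ e with
      map_lie' := by
        rintro x ⟨a⟩
        exact f.map_lie x a }⟩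

/-- The action of `A` on an abelian `A / B` is trivial, and the isomorphism with `S` transports
this. -/
theorem ideal_lie_eq_zero_of_isFactorIsoTo {B A : LieIdeal F L} (hab : IsAbelianFactor B A)
    (hiso : IsFactorIsoTo B A S) : ∀ x ∈ A, ∀ s : S, ⁅x, s⁆ = 0 := by
  intro x hx s
  obtain ⟨f, hf, hker⟩ := isFactorIsoTo_iff.mp hiso
  obtain ⟨a, rfl⟩ := hf s
  rw [← f.map_lie, hker]
  exact isAbelianFactor_iff.mp hab x hx a a.2

/-- A section is lifted to a linear endomorphism `τ` of `L`, multiplicative modulo `B`, so that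
splittings can be handled without quotients. -/
theorem isSplitFactor_iff {B A : LieIdeal F L} (h : B ≤ A) :
    IsSplitFactor h ↔ ∃ τ : L →ₗ[F] L, (∀ x, x - τ x ∈ A) ∧ (∀ a ∈ A, τ a ∈ B) ∧
      ∀ x y, τ ⁅x, y⁆ - ⁅τ x, τ y⁆ ∈ B := by
  constructor
  · rintro ⟨σ, hσ⟩
    obtain ⟨ρ, hρ⟩ := (B.toSubmodule.mkQ).exists_rightInverse_of_surjective
      (LinearMap.range_eq_top.mpr (Submodule.mkQ_surjective _))
    have hρ' : ∀ z : L ⧸ B, LieSubmodule.Quotient.mk (N := B) (ρ z) = z :=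
      fun z => LinearMap.congr_fun hρ z
    let τ : L →ₗ[F] L := ρ ∘ₗ (σ : (L ⧸ A) →ₗ[F] (L ⧸ B)) ∘ₗ A.toSubmodule.mkQ
    have hτ : ∀ x, LieSubmodule.Quotient.mk (N := B) (τ x) =
        σ (LieSubmodule.Quotient.mk (N := A) x) := fun x => hρ' _
    refine ⟨τ, fun x => ?_, fun a ha => ?_, fun x y => ?_⟩
    · have h1 := hσ (LieSubmodule.Quotient.mk (N := A) x)
      rw [← hτ] at h1
      exact (Submodule.Quotient.eq A.toSubmodule).mp h1.symm
    · rw [← LieSubmodule.Quotient.mk_eq_zero', hτ, LieSubmodule.Quotient.mk_eq_zero'.mpr ha,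
        map_zero]
    · refine (Submodule.Quotient.eq B.toSubmodule).mp ?_
      change LieSubmodule.Quotient.mk (N := B) (τ ⁅x, y⁆) =
        LieSubmodule.Quotient.mk (N := B) ⁅τ x, τ y⁆
      rw [hτ, LieSubmodule.Quotient.mk_bracket, LieSubmodule.Quotient.mk_bracket, hτ, hτ,
        LieHom.map_lie]
  · rintro ⟨τ, h1, h2, h3⟩
    let σ : (L ⧸ A) →ₗ[F] (L ⧸ B) := A.toSubmodule.liftQ (B.toSubmodule.mkQ ∘ₗ τ) (by
      intro a ha
      exact (Submodule.Quotient.mk_eq_zero _).mpr (h2 a ha))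
    refine ⟨{ σ with map_lie' := ?_ }, ?_⟩
    · rintro ⟨x⟩ ⟨y⟩
      exact (Submodule.Quotient.eq B.toSubmodule).mpr (h3 x y)
    · rintro ⟨x⟩
      refine (Submodule.Quotient.eq A.toSubmodule).mpr ?_
      rw [← neg_sub]
      exact neg_mem (h1 x)

/-- A split abelian chief factor gives rise to a derivation. -/
theorem exists_mem_lieCocyclesVanishing {B A : LieIdeal F L} (h : B ≤ A)
    (hA : ∀ x ∈ A, ∀ s : S, ⁅x, s⁆ = 0) (hiso : IsFactorIsoTo B A S) (hsplit : IsSplitFactor h) :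
    ∃ d ∈ lieCocyclesVanishing S B, (∀ a ∈ A, d a = 0 → a ∈ B) ∧ ∀ s, ∃ a ∈ A, d a = s := by
  obtain ⟨f, hf, hker⟩ := isFactorIsoTo_iff.mp hiso
  obtain ⟨τ, h1, h2, h3⟩ := (isSplitFactor_iff h).mp hsplit
  let g : L →ₗ[F] A := (LinearMap.id - τ).codRestrict A.toSubmodule h1
  have hg : ∀ x, (g x : L) = x - τ x := fun x => rfl
  -- The derivation is the component of `x` in `A / B` along the complement given by the splitting,
  -- read in `S`.
  let d : L →ₗ[F] S := (f : A →ₗ[F] S) ∘ₗ g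
  have hd : ∀ x, d x = f (g x) := fun x => rfl
  have hdA : ∀ a (ha : a ∈ A), d a = f ⟨a, ha⟩ := by
    intro a ha
    rw [hd, ← sub_eq_zero, ← map_sub, hker, LieSubmodule.coe_sub, hg, sub_sub_cancel_left]
    exact neg_mem (h2 a ha)
  refine ⟨d, ⟨fun x y => ?_, fun x hx => ?_⟩, fun a ha h0 => ?_, fun s => ?_⟩
  · have e1 : g ⁅x, y⁆ - (⁅τ x, g y⁆ - ⁅y, g x⁆) =
        ⟨-(τ ⁅x, y⁆ - ⁅τ x, τ y⁆), neg_mem (h (h3 x y))⟩ := by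
      apply Subtype.ext
      simp only [LieSubmodule.coe_sub, LieSubmodule.coe_bracket, hg, lie_sub]
      rw [← lie_skew x y, ← lie_skew (τ x) y]
      abel
    have e2 : f (g ⁅x, y⁆ - (⁅τ x, g y⁆ - ⁅y, g x⁆)) = 0 := by
      rw [e1, hker]
      exact neg_mem (h3 x y)
    have e3 : ⁅τ x, f (g y)⁆ = ⁅x, f (g y)⁆ := by
      have := hA _ (h1 x) (f (g y))
      rw [sub_lie, sub_eq_zero] at this
      exact this.symm
    rw [map_sub, map_sub, f.map_lie, f.map_lie, e3, sub_eq_zero] at e2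
    exact e2
  · rw [hdA x (h hx), hker]
    exact hx
  · rw [hdA a ha, hker] at h0
    exact h0
  · obtain ⟨a, rfl⟩ := hf s
    exact ⟨a, a.2, hdA a a.2⟩

/-- A derivation that vanishes on `B` but not on `A` splits the chief factor `A / B`. -/
theorem isSplitFactor_of_mem_lieCocyclesVanishing [LieModule.IsIrreducible F L S]
    {B A : LieIdeal F L} (h : B ⋖ A) (hA : ∀ x ∈ A, ∀ s : S, ⁅x, s⁆ = 0) {d : L →ₗ[F] S}
    (hd : d ∈ lieCocyclesVanishing S B) (hdA : ¬ ∀ a ∈ A, d a = 0) :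
    IsAbelianFactor B A ∧ IsFactorIsoTo B A S ∧ IsSplitFactor h.le := by
  let f : A →ₗ⁅F,L⁆ S :=
    { d ∘ₗ A.toSubmodule.subtype with
      map_lie' := by
        intro x a
        change d ⁅x, (a : L)⁆ = ⁅x, d a⁆
        rw [hd.1, hA a a.2, sub_zero] }
  have hsurj : Function.Surjective f := by
    rw [← LieModuleHom.range_eq_top]
    refine (eq_bot_or_eq_top f.range).resolve_left fun hbot => hdA fun a ha => ?_
    have : f ⟨a, ha⟩ ∈ f.range := (f.mem_range _).mpr ⟨_, rfl⟩
    rw [hbot] at this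
    exact (LieSubmodule.mem_bot _).mp this
  -- The kernel of `d` on `A` is an ideal between `B` and `A`; as `d` is nonzero on `A`, it must be
  -- `B`.
  let K : LieIdeal F L :=
    { A.toSubmodule ⊓ LinearMap.ker d with
      lie_mem := by
        rintro x a ⟨ha, hda⟩
        refine ⟨lie_mem_right F L A x a ha, ?_⟩
        change d a = 0 at hda
        change d ⁅x, a⁆ = 0
        rw [hd.1, hda, hA a ha, lie_zero, sub_zero] }
  have hK : ∀ a, a ∈ K ↔ a ∈ A ∧ d a = 0 := fun a => Iff.rfl
  have hKB : K = B := by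
    refine (h.eq_or_eq (c := K) (fun b hb => (hK b).mpr ⟨h.le hb, hd.2 b hb⟩)
      (fun a ha => ((hK a).mp ha).1)).resolve_right fun hKA => hdA fun a ha => ?_
    rw [← hKA] at ha
    exact ((hK a).mp ha).2
  have hker : ∀ a ∈ A, d a = 0 → a ∈ B := fun a ha h0 => by
    rw [← hKB, hK]
    exact ⟨ha, h0⟩
  refine ⟨?_, ?_, ?_⟩
  · rw [isAbelianFactor_iff]
    intro a ha b hb
    refine hker _ (lie_mem_right F L A a b hb) ?_
    rw [hd.1, hA a ha, hA b hb, sub_zero]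
  · exact isFactorIsoTo_iff.mpr ⟨f, hsurj, fun a => ⟨hker a a.2, hd.2 a⟩⟩
  · obtain ⟨r, hr⟩ := (f : A →ₗ[F] S).exists_rightInverse_of_surjective
      (LinearMap.range_eq_top.mpr hsurj)
    have hr' : ∀ s, d (r s) = s := fun s => LinearMap.congr_fun hr s
    -- A projection onto the kernel of `d` along a linear complement of `B` in `A`. The kernel of a
    -- derivation is a subalgebra, and it meets `A` in `B`, so `τ` is multiplicative modulo `B`.
    let τ : L →ₗ[F] L := LinearMap.id - A.toSubmodule.subtype ∘ₗ r ∘ₗ d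
    have hτ : ∀ x, τ x = x - (r (d x) : L) := fun x => rfl
    have hdτ : ∀ x, d (τ x) = 0 := fun x => by rw [hτ, map_sub, hr', sub_self]
    have hτA : ∀ x, x - τ x ∈ A := fun x => by
      rw [hτ, sub_sub_cancel]
      exact (r (d x)).2
    refine (isSplitFactor_iff h.le).mpr ⟨τ, hτA, fun a ha => ?_, fun x y => ?_⟩
    · refine hker _ ?_ (hdτ a)
      rw [hτ]
      exact sub_mem ha (r (d a)).2
    · refine hker _ ?_ ?_
      · have e : τ ⁅x, y⁆ - ⁅τ x, τ y⁆ =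
            ⁅x - τ x, y⁆ + ⁅τ x, y - τ y⁆ - (⁅x, y⁆ - τ ⁅x, y⁆) := by
          rw [sub_lie, lie_sub]
          abel
        rw [e]
        exact sub_mem (add_mem (lie_mem_left F L A _ _ (hτA x))
          (lie_mem_right F L A _ _ (hτA y))) (hτA _)
      · rw [map_sub, hdτ, hd.1, hdτ, hdτ, lie_zero, lie_zero, sub_zero, sub_zero]

instance [FiniteDimensional F S] : Module.Finite F (S →ₗ⁅F,L⁆ S) := by
  let Φ : (S →ₗ⁅F,L⁆ S) →ₗ[F] (S →ₗ[F] S) :=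
    { toFun := fun φ => (φ : S →ₗ[F] S)
      map_add' := fun _ _ => rfl
      map_smul' := fun _ _ => rfl }
  exact Module.Finite.of_injective Φ fun _ _ h => LieModuleHom.ext fun s => LinearMap.congr_fun h s

/-- On `A`, a derivation vanishing on `B` is a module map factoring through `A / B`, which `d₀`
identifies with `S`. It therefore agrees there with `φ ∘ d₀` for a unique endomorphism `φ`, and the
difference vanishes on `A`. -/
theorem finrank_lieCocyclesVanishing_of_split [FiniteDimensional F L] [FiniteDimensional F S]
    {B A : LieIdeal F L} (h : B ≤ A)
    (hA : ∀ x ∈ A, ∀ s : S, ⁅x, s⁆ = 0) {d₀ : L →ₗ[F] S} (hd₀ : d₀ ∈ lieCocyclesVanishing S B)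
    (hker : ∀ a ∈ A, d₀ a = 0 → a ∈ B) (hsurj : ∀ s, ∃ a ∈ A, d₀ a = s) :
    Module.finrank F (lieCocyclesVanishing S B) =
      Module.finrank F (lieCocyclesVanishing S A) + Module.finrank F (S →ₗ⁅F,L⁆ S) := by
  have hcomp : ∀ φ : S →ₗ⁅F,L⁆ S, (φ : S →ₗ[F] S) ∘ₗ d₀ ∈ lieCocyclesVanishing S B := by
    intro φ
    refine ⟨fun x y => ?_, fun x hx => ?_⟩
    · simp only [LinearMap.comp_apply, LieModuleHom.coe_toLinearMap]
      rw [hd₀.1, map_sub, φ.map_lie, φ.map_lie]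
    · simp only [LinearMap.comp_apply, LieModuleHom.coe_toLinearMap]
      rw [hd₀.2 x hx, map_zero]
  let Φ : (lieCocyclesVanishing S A × (S →ₗ⁅F,L⁆ S)) →ₗ[F] lieCocyclesVanishing S B :=
    { toFun := fun q => ⟨q.1 + (q.2 : S →ₗ[F] S) ∘ₗ d₀,
        add_mem (lieCocyclesVanishing_mono h q.1.2) (hcomp q.2)⟩
      map_add' := by
        intro q q'
        apply Subtype.ext
        ext x
        simp
        abel
      map_smul' := by
        intro c q
        apply Subtype.ext
        ext x
        simp }
  have hΦ : ∀ q x, (Φ q : L →ₗ[F] S) x = (q.1 : L →ₗ[F] S) x + q.2 (d₀ x) := fun q x => rfl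
  have hbij : Function.Bijective Φ := by
    constructor
    · rw [← LinearMap.ker_eq_bot, eq_bot_iff]
      intro q hq
      have hq0 : ∀ x, (q.1 : L →ₗ[F] S) x + q.2 (d₀ x) = 0 := fun x => by
        rw [← hΦ, LinearMap.mem_ker.mp hq]
        rfl
      have hφ : q.2 = 0 := by
        ext s
        obtain ⟨a, ha, rfl⟩ := hsurj s
        have := hq0 a
        rw [q.1.2.2 a ha, zero_add] at this
        exact this
      have hd : q.1 = 0 := by
        apply Subtype.ext
        ext x
        have := hq0 x
        rw [hφ] at this
        simpa using this
      exact Prod.ext hd hφ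
    · intro d
      let f : A →ₗ[F] S := d₀ ∘ₗ A.toSubmodule.subtype
      obtain ⟨r, hr⟩ := f.exists_rightInverse_of_surjective (LinearMap.range_eq_top.mpr fun s => by
        obtain ⟨a, ha, hs⟩ := hsurj s
        exact ⟨⟨a, ha⟩, hs⟩)
      have hr' : ∀ s, d₀ (r s) = s := fun s => LinearMap.congr_fun hr s
      let φ₀ : S →ₗ[F] S := (d : L →ₗ[F] S) ∘ₗ A.toSubmodule.subtype ∘ₗ r
      have hφ₀ : ∀ a ∈ A, φ₀ (d₀ a) = (d : L →ₗ[F] S) a := by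
        intro a ha
        have hmem : (r (d₀ a) : L) - a ∈ B :=
          hker _ (sub_mem (r (d₀ a)).2 ha) (by rw [map_sub, hr', sub_self])
        have := d.2.2 _ hmem
        rw [map_sub, sub_eq_zero] at this
        exact this
      let φ : S →ₗ⁅F,L⁆ S :=
        { φ₀ with
          map_lie' := by
            intro x s
            obtain ⟨a, ha, rfl⟩ := hsurj s
            change φ₀ ⁅x, d₀ a⁆ = ⁅x, φ₀ (d₀ a)⁆
            have e1 : ⁅x, d₀ a⁆ = d₀ ⁅x, a⁆ := by rw [hd₀.1, hA a ha, sub_zero]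
            rw [e1, hφ₀ _ (lie_mem_right F L A x a ha), hφ₀ a ha, d.2.1, hA a ha, sub_zero] }
      refine ⟨(⟨d - (φ : S →ₗ[F] S) ∘ₗ d₀,
        ⟨sub_mem d.2.1 (hcomp φ).1, fun a ha => ?_⟩⟩, φ), ?_⟩
      · exact sub_eq_zero.mpr (hφ₀ a ha).symm
      · apply Subtype.ext
        exact sub_add_cancel _ _
  rw [← (LinearEquiv.ofBijective Φ hbij).finrank_eq, Module.finrank_prod]

/-- The first cohomology of an irreducible module of a solvable Lie algebra is counted by the
split chief factors isomorphic to that module. -/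
theorem finrank_lieCocycles_eq [FiniteDimensional F L] [FiniteDimensional F S]
    [LieAlgebra.IsSolvable L] [LieModule.IsIrreducible F L S] (c : ChiefSeries F L) :
    Module.finrank F (lieCocycles F L S) = Module.finrank F (lieCoboundaries F L S) +
      Module.finrank F (S →ₗ⁅F,L⁆ S) * c.splitMultiplicity S := by
  have hcov : ∀ j : Fin c.series.length, c.series j.castSucc ⋖ c.series j.succ :=
    fun j => c.series.step j
  -- The tracked dimension starts at that of all derivations and ends at that of the inner ones. The
  -- count is over `ℤ` because it decreases.
  have key := last_eq_zero_add_mul_card (-(Module.finrank F (S →ₗ⁅F,L⁆ S) : ℤ))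
    (fun j => (Module.finrank F
      (lieCocyclesVanishing S (c.series j) ⊔ lieCoboundaries F L S : Submodule F (L →ₗ[F] S)) : ℤ))
    (fun j => IsAbelianFactor (c.series j.castSucc) (c.series j.succ) ∧
      IsFactorIsoTo (c.series j.castSucc) (c.series j.succ) S ∧
      IsSplitFactor (c.series.lt_succ j).le)
    (by
      rintro j ⟨hab, hiso, hsplit⟩
      have hA := ideal_lie_eq_zero_of_isFactorIsoTo hab hiso
      obtain ⟨d, hd, h1, h2⟩ := exists_mem_lieCocyclesVanishing (hcov j).le hA hiso hsplit
      have := finrank_lieCocyclesVanishing_of_split (hcov j).le hA hd h1 h2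
      rw [sup_eq_left.mpr (lieCoboundaries_le_lieCocyclesVanishing hA),
        sup_eq_left.mpr (lieCoboundaries_le_lieCocyclesVanishing
          fun x hx => hA x ((hcov j).le hx)), this]
      push_cast
      ring)
    (by
      intro j hj
      have hmono := lieCocyclesVanishing_mono (S := S) (hcov j).le
      suffices h : lieCocyclesVanishing S (c.series j.succ) ⊔ lieCoboundaries F L S =
          lieCocyclesVanishing S (c.series j.castSucc) ⊔ lieCoboundaries F L S by rw [h]
      -- At a factor not counted: if both ideals act trivially, a derivation vanishing on the
      -- smaller ideal only would split the factor; if only the larger acts nontrivially, both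
      -- spaces consist of inner derivations; if the smaller acts nontrivially, both are zero.
      by_cases hB : ∀ x ∈ c.series j.castSucc, ∀ s : S, ⁅x, s⁆ = 0
      · by_cases hA : ∀ x ∈ c.series j.succ, ∀ s : S, ⁅x, s⁆ = 0
        · have : lieCocyclesVanishing S (c.series j.castSucc) ≤
              lieCocyclesVanishing S (c.series j.succ) := fun d hd => by
            refine ⟨hd.1, ?_⟩
            by_contra hdA
            exact hj (isSplitFactor_of_mem_lieCocyclesVanishing (hcov j) hA hd hdA)
          rw [le_antisymm hmono this]
        · have := lieCocyclesVanishing_le_lieCoboundaries (hcov j) hB hA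
          rw [sup_eq_right.mpr this, sup_eq_right.mpr (hmono.trans this)]
      · rw [lieCocyclesVanishing_eq_bot hB, le_bot_iff.mp
          (hmono.trans (lieCocyclesVanishing_eq_bot hB).le)])
  have hlast : lieCocyclesVanishing S (c.series (Fin.last _)) = ⊥ := by
    have : c.series (Fin.last _) = ⊤ := c.last_eq
    rw [this, eq_bot_iff]
    intro d hd
    exact LinearMap.ext fun x => hd.2 x (LieSubmodule.mem_top x)
  have hfirst : lieCocyclesVanishing S (c.series 0) = lieCocycles F L S := by
    have : c.series 0 = ⊥ := c.head_eq
    rw [this]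
    refine le_antisymm (fun d hd => hd.1) fun d hd => ⟨hd, fun x hx => ?_⟩
    rw [(LieSubmodule.mem_bot x).mp hx, map_zero]
  rw [hlast, hfirst, bot_sup_eq, sup_eq_left.mpr lieCoboundaries_le] at key
  rw [ChiefSeries.splitMultiplicity]
  zify
  linarith

end Derivations

/-! ### Extensions of the trivial module and restricted derivations -/

section Extension

variable {F L S : Type*} [Field F] [LieRing L] [LieAlgebra F L] [AddCommGroup S] [Module F S]
  [LieRingModule L S] [LieModule F L S]

/-- The representation of `L` on `S × F` defined by a derivation with values in `S`: an extension
of the trivial module by `S`. -/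
def extensionRep (d : L →ₗ[F] S) (hd : d ∈ lieCocycles F L S) : L →ₗ⁅F⁆ Module.End F (S × F) where
  toFun x :=
    LinearMap.inl F S F ∘ₗ (LieModule.toEnd F L S x).coprod (LinearMap.toSpanSingleton F S (d x))
  map_add' x y := by
    ext <;> simp
  map_smul' c x := by
    ext <;> simp
  map_lie' := by
    intro x y
    have h := hd x y
    ext <;> simp [LieRing.of_associative_ring_bracket, h]

theorem extensionRep_apply {d : L →ₗ[F] S} (hd : d ∈ lieCocycles F L S) (x : L) (v : S × F) :
    extensionRep d hd x v = (⁅x, v.1⁆ + v.2 • d x, 0) := by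
  simp [extensionRep]

/-- For the exponent `p` this identifies the condition `d (x^[p]) = x ^ (p - 1) d x` as what makes
the extension of a restricted module restricted. -/
theorem extensionRep_pow_apply {d : L →ₗ[F] S} (hd : d ∈ lieCocycles F L S) (x : L) (v : S × F)
    (k : ℕ) : (extensionRep d hd x ^ (k + 1)) v =
      ((LieModule.toEnd F L S x ^ (k + 1)) v.1 + v.2 • (LieModule.toEnd F L S x ^ k) (d x), 0) := by
  induction k with
  | zero => simp [extensionRep_apply]
  | succ k ih =>
    rw [pow_succ', Module.End.mul_apply, ih, extensionRep_apply, pow_succ' _ (k + 1), pow_succ' _ k]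
    simp only [Module.End.mul_apply, LieModule.toEnd_apply_apply, lie_add, lie_smul, zero_smul,
      add_zero]

end Extension

section RestrictedCocycles

variable (F : Type*) (p : ℕ) (L S : Type*) [Field F] [LieRing L] [LieAlgebra F L]
  [RestrictedLieAlgebra F p L] [AddCommGroup S] [Module F S]
  [LieRingModule L S] [LieModule F L S]

/-- The restricted 1-cocycles, i.e. the derivations `d` with `d (x^[p]) = x ^ (p - 1) d x`. -/
def restrictedCocycles : Submodule F (L →ₗ[F] S) where
  carrier := {d | d ∈ lieCocycles F L S ∧
    ∀ x, d (pMap F p x) = (LieModule.toEnd F L S x ^ (p - 1)) (d x)}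
  add_mem' := by
    rintro d d' ⟨h, h0⟩ ⟨h', h0'⟩
    exact ⟨add_mem h h', fun x => by
      rw [LinearMap.add_apply, LinearMap.add_apply, h0, h0', map_add]⟩
  zero_mem' := ⟨zero_mem _, fun _ => by simp⟩
  smul_mem' := by
    rintro c d ⟨h, h0⟩
    exact ⟨Submodule.smul_mem _ c h, fun x => by
      rw [LinearMap.smul_apply, LinearMap.smul_apply, h0, map_smul]⟩

variable {F p L S}

theorem IsRestrictedModule.lie_pMap (h : IsRestrictedModule F p L S) (x : L) (s : S) :
    ⁅pMap F p x, s⁆ = (LieModule.toEnd F L S x ^ p) s := by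
  rw [← h x, LieModule.toEnd_apply_apply]

theorem lieCoboundaries_le_restrictedCocycles [Fact p.Prime] (h : IsRestrictedModule F p L S) :
    lieCoboundaries F L S ≤ restrictedCocycles F p L S := by
  intro d hd
  refine ⟨lieCoboundaries_le hd, fun x => ?_⟩
  obtain ⟨s, hs⟩ := mem_lieCoboundaries.mp hd
  rw [hs, hs, h.lie_pMap, ← LieModule.toEnd_apply_apply F L S x s, ← Module.End.mul_apply,
    ← pow_succ, Nat.sub_add_cancel (Fact.out : p.Prime).one_le]

/-- Left and right multiplication by `x` commute, so the `p`-th power of their difference is the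
difference of the `p`-th powers. -/
theorem lie_pow_char {B : Type*} [Ring B] [Algebra F B] [Fact p.Prime] [CharP F p]
    (x y : B) : ((LieAlgebra.ad F B x) ^ p) y = x ^ p * y - y * x ^ p := by
  rcases subsingleton_or_nontrivial B with hB | hB
  · exact Subsingleton.elim _ _
  have : CharP (Module.End F B) p :=
    charP_of_injective_algebraMap (FaithfulSMul.algebraMap_injective F (Module.End F B)) p
  have h : LieAlgebra.ad F B x = LinearMap.mulLeft F x - LinearMap.mulRight F x := by
    ext y
    simp [LieRing.of_associative_ring_bracket]
  rw [h, sub_pow_char_of_commute p (LinearMap.commute_mulLeft_right x x), LinearMap.pow_mulLeft,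
    LinearMap.pow_mulRight]
  simp

/-- With values in a restricted module without invariants, every derivation is restricted. -/
theorem lieCocycles_le_restrictedCocycles [Fact p.Prime] [CharP F p]
    (h : IsRestrictedModule F p L S) (hinv : ∀ s : S, (∀ y : L, ⁅y, s⁆ = 0) → s = 0) :
    lieCocycles F L S ≤ restrictedCocycles F p L S := by
  intro d hd
  refine ⟨hd, fun x => ?_⟩
  rw [← sub_eq_zero]
  refine hinv _ fun y => ?_
  set ρ := extensionRep d hd with hρ
  have hp : p - 1 + 1 = p := Nat.sub_add_cancel (Fact.out : p.Prime).one_le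
  have had : ∀ k : ℕ, ρ ((LieAlgebra.ad F L x ^ k) y) =
      (LieAlgebra.ad F (Module.End F (S × F)) (ρ x) ^ k) (ρ y) := by
    intro k
    induction k with
    | zero => rfl
    | succ k ih =>
      rw [pow_succ', pow_succ', Module.End.mul_apply, Module.End.mul_apply, LieAlgebra.ad_apply,
        LieAlgebra.ad_apply, LieHom.map_lie, ih]
  -- In the extension, `x^[p]` and `x ^ p` have the same commutator with `y`. Evaluated at `(0, 1)`,
  -- this says that `y` kills `d (x^[p]) - x ^ (p - 1) d x`.
  have h1 : ρ (pMap F p x) * ρ y - ρ y * ρ (pMap F p x) = ρ x ^ p * ρ y - ρ y * ρ x ^ p := by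
    rw [← lie_pow_char (F := F) (ρ x) (ρ y), ← had p, ← RestrictedLieAlgebra.ad_pMap, LieAlgebra.ad_apply,
      LieHom.map_lie, LieRing.of_associative_ring_bracket]
  have h2 := LinearMap.congr_fun h1 ((0, 1) : S × F)
  have hpow : ∀ v : S × F, (ρ x ^ p) v = ((LieModule.toEnd F L S x ^ p) v.1 +
      v.2 • (LieModule.toEnd F L S x ^ (p - 1)) (d x), 0) := fun v => by
    have := extensionRep_pow_apply hd x v (p - 1)
    rwa [hp] at this
  have h3 := congrArg Prod.fst h2
  simp only [LinearMap.sub_apply, Module.End.mul_apply, hpow] at h3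
  simp only [hρ, extensionRep_apply, h.lie_pMap] at h3
  simp only [lie_zero, map_zero, zero_add, one_smul, zero_smul, add_zero, Prod.fst_sub] at h3
  rw [sub_right_inj] at h3
  rw [lie_sub, h3, sub_self]

end RestrictedCocycles

/-! ### Linearity over the restricted enveloping algebra and the augmentation ideal -/

namespace RestrictedEnvelopingAlgebra

variable {F : Type*} {p : ℕ} {L : Type*} [Field F] [LieRing L] [LieAlgebra F L]
  [RestrictedLieAlgebra F p L]

/-- A linear map between `u(L)`-modules that is compatible with the action of `L` is
`u(L)`-linear. -/
theorem map_smul_of_map_of_smul {M N : Type*} [AddCommGroup M] [AddCommGroup N] [Module F M]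
    [Module F N] [Module (RestrictedEnvelopingAlgebra F p L) M]
    [Module (RestrictedEnvelopingAlgebra F p L) N]
    [IsScalarTower F (RestrictedEnvelopingAlgebra F p L) M]
    [IsScalarTower F (RestrictedEnvelopingAlgebra F p L) N] (f : M →ₗ[F] N)
    (hf : ∀ (x : L) (m : M), f (of F p x • m) = of F p x • f m)
    (a : RestrictedEnvelopingAlgebra F p L) (m : M) : f (a • m) = a • f m := by
  have ha : a ∈ Algebra.adjoin F
      (Set.range (of F p : L → RestrictedEnvelopingAlgebra F p L)) := by
    rw [adjoin_range_of]
    trivial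
  induction ha using Algebra.adjoin_induction generalizing m with
  | mem a ha =>
    obtain ⟨x, rfl⟩ := ha
    exact hf x m
  | algebraMap c => rw [algebraMap_smul, algebraMap_smul, map_smul]
  | add a b _ _ ha hb => rw [add_smul, add_smul, map_add, ha, hb]
  | mul a b _ _ ha hb => rw [mul_smul, mul_smul, ha, hb]

variable (F p L) in
/-- The augmentation ideal of `u(L)`, as the left ideal generated by `L`. -/
def augmentationIdeal : Ideal (RestrictedEnvelopingAlgebra F p L) :=
  Ideal.span (Set.range (of F p : L → RestrictedEnvelopingAlgebra F p L))

theorem exists_sub_algebraMap_mem_augmentationIdeal (a : RestrictedEnvelopingAlgebra F p L) :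
    ∃ c : F, a - algebraMap F _ c ∈ augmentationIdeal F p L := by
  have ha : a ∈ Algebra.adjoin F
      (Set.range (of F p : L → RestrictedEnvelopingAlgebra F p L)) := by
    rw [adjoin_range_of]
    trivial
  induction ha using Algebra.adjoin_induction with
  | mem a ha => exact ⟨0, by rw [map_zero, sub_zero]; exact Ideal.subset_span ha⟩
  | algebraMap c => exact ⟨c, by rw [sub_self]; exact zero_mem _⟩
  | add a b _ _ ha hb =>
    obtain ⟨c, hc⟩ := ha
    obtain ⟨c', hc'⟩ := hb
    refine ⟨c + c', ?_⟩
    rw [map_add, add_sub_add_comm]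
    exact add_mem hc hc'
  | mul a b _ _ ha hb =>
    obtain ⟨c, hc⟩ := ha
    obtain ⟨c', hc'⟩ := hb
    refine ⟨c * c', ?_⟩
    have : a * b - algebraMap F _ (c * c') =
        a * (b - algebraMap F _ c') + algebraMap F _ c' * (a - algebraMap F _ c) := by
      rw [map_mul, mul_sub, mul_sub, Algebra.commutes c' a, Algebra.commutes c' (algebraMap F _ c)]
      abel
    rw [this]
    exact add_mem (Ideal.mul_mem_left _ _ hc') (Ideal.mul_mem_left _ _ hc)

end RestrictedEnvelopingAlgebra

namespace IsRestrictedModule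

variable {F : Type*} {p : ℕ} {L M : Type*} [Field F] [LieRing L] [LieAlgebra F L]
  [RestrictedLieAlgebra F p L] [AddCommGroup M] [Module F M] [LieRingModule L M] [LieModule F L M]

instance (h : IsRestrictedModule F p L M) : Module F h.AsModule := inferInstanceAs (Module F M)

instance (h : IsRestrictedModule F p L M) : LieRingModule L h.AsModule :=
  inferInstanceAs (LieRingModule L M)

instance (h : IsRestrictedModule F p L M) : LieModule F L h.AsModule :=
  inferInstanceAs (LieModule F L M)

instance (h : IsRestrictedModule F p L M) :
    IsScalarTower F (RestrictedEnvelopingAlgebra F p L) h.AsModule where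
  smul_assoc c a m := by
    change h.toEnd (c • a) m = c • h.toEnd a m
    rw [map_smul]
    rfl

end IsRestrictedModule

/-! ### Loewy layers over semiprimary rings -/

section Loewy

variable {A P : Type*} [Ring A] [AddCommGroup P] [Module A P]

theorem loewySeries_one : loewySeries A P 1 = Ring.jacobson A • (⊤ : Submodule A P) := rfl

theorem loewySeries_two :
    loewySeries A P 2 = Ring.jacobson A • loewySeries A P 1 := rfl

/-- Nakayama's lemma for a nilpotent radical, which needs no finite generation; that the projective
cover is finitely generated is deduced from it. -/
theorem eq_top_of_sup_jacobson_smul_eq_top [IsSemiprimaryRing A] {N : Submodule A P}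
    (h : N ⊔ Ring.jacobson A • ⊤ = ⊤) : N = ⊤ := by
  obtain ⟨k, hk⟩ := IsSemiprimaryRing.isNilpotent (R := A)
  have key : ∀ k : ℕ, N ⊔ (Ring.jacobson A ^ k) • (⊤ : Submodule A P) = ⊤ := by
    intro k
    induction k with
    | zero => rw [Submodule.pow_zero, Ideal.one_eq_top, Submodule.top_smul, sup_top_eq]
    | succ k ih =>
      rw [eq_top_iff]
      calc (⊤ : Submodule A P) ≤ N ⊔ (Ring.jacobson A ^ k) • (⊤ : Submodule A P) := ih.ge
        _ ≤ N ⊔ (Ring.jacobson A ^ k) • (N ⊔ Ring.jacobson A • (⊤ : Submodule A P)) := by rw [h]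
        _ ≤ N ⊔ (Ring.jacobson A ^ (k + 1)) • (⊤ : Submodule A P) := by
          rw [Submodule.smul_sup, Submodule.pow_succ, Submodule.mul_smul]
          exact sup_le le_sup_left (sup_le (Submodule.smul_le_right.trans le_sup_left) le_sup_right)
  have := key k
  rwa [hk, Submodule.zero_eq_bot, Submodule.bot_smul, sup_bot_eq] at this

theorem isSemisimpleModule_secondLoewyLayer [IsSemiprimaryRing A] :
    IsSemisimpleModule A (SecondLoewyLayer A P) := by
  have h : Module.IsTorsionBySet A (SecondLoewyLayer A P) (Ring.jacobson A) := by
    rintro u ⟨j, hj⟩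
    induction u using Submodule.Quotient.induction_on with
    | H u =>
      refine (Submodule.Quotient.mk_eq_zero _).mpr ?_
      exact Submodule.smul_mem_smul (N := loewySeries A P 1) hj u.2
  let _ := h.module
  exact h.isSemisimpleModule_iff.mp inferInstance

theorem isFiniteLength_secondLoewyLayer [IsArtinianRing A] [Module.Finite A P] :
    IsFiniteLength A (SecondLoewyLayer A P) := by
  rw [isFiniteLength_iff_isNoetherian_isArtinian]
  exact ⟨inferInstance, inferInstance⟩

variable (F : Type*) {S : Type*} [Field F] [AddCommGroup S] [Module F S] [Module A S]
  [SMulCommClass A F S] [IsSemisimpleModule A S]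

theorem map_eq_zero_of_mem_loewySeries_two (f : loewySeries A P 1 →ₗ[A] S)
    {u : P} (hu : u ∈ loewySeries A P 2) : ∃ h : u ∈ loewySeries A P 1, f ⟨u, h⟩ = 0 := by
  rw [loewySeries_two] at hu
  induction hu using Submodule.smul_induction_on' with
  | smul j hj u hu =>
    refine ⟨Submodule.smul_mem _ j hu, ?_⟩
    have : f (j • ⟨u, hu⟩) = 0 := by
      rw [map_smul]
      exact Module.mem_annihilator.mp (IsSemisimpleModule.jacobson_le_annihilator A S hj) _
    exact this
  | add u hu v hv ihu ihv =>
    obtain ⟨h, h0⟩ := ihu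
    obtain ⟨h', h0'⟩ := ihv
    refine ⟨add_mem h h', ?_⟩
    have : f (⟨u, h⟩ + ⟨v, h'⟩) = 0 := by rw [map_add, h0, h0', add_zero]
    exact this

variable (A P S) in
/-- Homomorphisms from the second Loewy layer to a semisimple module are the homomorphisms from
the radical. -/
theorem finrank_hom_secondLoewyLayer :
    Module.finrank F (SecondLoewyLayer A P →ₗ[A] S) =
      Module.finrank F (loewySeries A P 1 →ₗ[A] S) := by
  let Φ : (SecondLoewyLayer A P →ₗ[A] S) →ₗ[F] (loewySeries A P 1 →ₗ[A] S) :=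
    { toFun := fun g => g ∘ₗ Submodule.mkQ _
      map_add' := fun _ _ => rfl
      map_smul' := fun _ _ => rfl }
  refine (LinearEquiv.ofBijective Φ ⟨fun g g' h => ?_, fun f => ?_⟩).finrank_eq
  · exact Submodule.linearMap_qext _ h
  · refine ⟨Submodule.liftQ _ f fun u hu => ?_, Submodule.liftQ_mkQ _ _ _⟩
    obtain ⟨_, h⟩ := map_eq_zero_of_mem_loewySeries_two f hu
    exact h

end Loewy

theorem of_pow_smul {F : Type*} {p : ℕ} {L S : Type*} [Field F] [LieRing L] [LieAlgebra F L]
    [RestrictedLieAlgebra F p L] [AddCommGroup S] [Module F S] [LieRingModule L S]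
    [LieModule F L S] [Module (RestrictedEnvelopingAlgebra F p L) S]
    (hc : ∀ (x : L) (s : S), RestrictedEnvelopingAlgebra.of F p x • s = ⁅x, s⁆)
    (x : L) (k : ℕ) (s : S) :
    RestrictedEnvelopingAlgebra.of F p x ^ k • s = (LieModule.toEnd F L S x ^ k) s := by
  induction k with
  | zero => simp
  | succ k ih => rw [pow_succ', pow_succ', mul_smul, ih, hc]; rfl

/-! ### Irreducible restricted modules as simple modules -/

section Simple

variable {F : Type*} {p : ℕ} {L S : Type*} [Field F] [LieRing L]
  [LieAlgebra F L] [RestrictedLieAlgebra F p L] [AddCommGroup S] [Module F S]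
  [LieRingModule L S] [Module (RestrictedEnvelopingAlgebra F p L) S]
  [IsScalarTower F (RestrictedEnvelopingAlgebra F p L) S]

theorem isSimpleModule_of_isIrreducible [LieModule.IsIrreducible F L S]
    (hc : ∀ (x : L) (s : S), RestrictedEnvelopingAlgebra.of F p x • s = ⁅x, s⁆) :
    IsSimpleModule (RestrictedEnvelopingAlgebra F p L) S := by
  have : Nontrivial S := LieModule.nontrivial_of_isIrreducible F L S
  rw [isSimpleModule_iff]
  refine { exists_pair_ne := ⟨⊥, ⊤, bot_ne_top⟩, eq_bot_or_eq_top := fun N => ?_ }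
  let N' : LieSubmodule F L S :=
    { N.restrictScalars F with
      lie_mem := fun {x s} hs => by
        rw [← hc]
        exact N.smul_mem _ hs }
  have hN : ∀ s, s ∈ N' ↔ s ∈ N := fun s => Iff.rfl
  rcases eq_bot_or_eq_top N' with h | h
  · left
    ext s
    rw [← hN, h, LieSubmodule.mem_bot, Submodule.mem_bot]
  · right
    ext s
    rw [← hN, h]
    simp

theorem finiteDimensional_of_isIrreducible [LieModule F L S] [Fact p.Prime] [FiniteDimensional F L]
    [LieModule.IsIrreducible F L S]
    (hc : ∀ (x : L) (s : S), RestrictedEnvelopingAlgebra.of F p x • s = ⁅x, s⁆) :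
    FiniteDimensional F S := by
  have := isSimpleModule_of_isIrreducible hc
  exact Module.Finite.trans (RestrictedEnvelopingAlgebra F p L) S

theorem finrank_end_eq [LieModule F L S]
    (hc : ∀ (x : L) (s : S), RestrictedEnvelopingAlgebra.of F p x • s = ⁅x, s⁆) :
    Module.finrank F (S →ₗ[RestrictedEnvelopingAlgebra F p L] S) =
      Module.finrank F (S →ₗ⁅F,L⁆ S) := by
  let Φ : (S →ₗ[RestrictedEnvelopingAlgebra F p L] S) →ₗ[F] (S →ₗ⁅F,L⁆ S) :=
    { toFun := fun φ =>
        { φ.restrictScalars F with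
          map_lie' := by
            intro x s
            change φ ⁅x, s⁆ = ⁅x, φ s⁆
            rw [← hc, map_smul, hc] }
      map_add' := fun _ _ => rfl
      map_smul' := fun _ _ => rfl }
  refine (LinearEquiv.ofBijective Φ ⟨fun φ φ' h => ?_, fun φ => ?_⟩).finrank_eq
  · ext s
    exact LieModuleHom.congr_fun h s
  · exact ⟨{ φ with
      map_smul' := RestrictedEnvelopingAlgebra.map_smul_of_map_of_smul (φ : S →ₗ[F] S)
        fun x s => by rw [hc, hc]; exact φ.map_lie x s }, rfl⟩

end Simple

/-! ### The radical of the projective cover and restricted derivations -/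

section ProjectiveCover

variable {F : Type*} {p : ℕ} [Fact p.Prime] {L S : Type*} [Field F] [LieRing L]
  [LieAlgebra F L] [RestrictedLieAlgebra F p L]

theorem isIrreducible_trivial :
    LieModule.IsIrreducible F L (isRestrictedModule_trivial F p L).AsModule := by
  have : Nontrivial (isRestrictedModule_trivial F p L).AsModule :=
    inferInstanceAs (Nontrivial F)
  refine LieModule.IsIrreducible.mk fun N hN => ?_
  have h := (eq_bot_or_eq_top (α := Submodule F F) N.toSubmodule).resolve_left fun h => hN ?_
  · exact (LieSubmodule.toSubmodule_eq_top N).mp h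
  · exact (LieSubmodule.toSubmodule_eq_bot N).mp h

/-- The generator of the trivial module. -/
def trivialOne (F : Type*) (p : ℕ) [Fact p.Prime] (L : Type*) [Field F] [LieRing L]
    [LieAlgebra F L] [RestrictedLieAlgebra F p L] :
    (isRestrictedModule_trivial F p L).AsModule := (1 : F)

theorem of_smul_trivial (x : L) (t : (isRestrictedModule_trivial F p L).AsModule) :
    RestrictedEnvelopingAlgebra.of F p x • t = 0 := by
  have := (isRestrictedModule_trivial F p L).of_smul x t
  exact this.trans (trivial_lie_zero L (TrivialLieModule F L F) x t)

theorem smul_eq_zero_of_mem_augmentationIdeal {a : RestrictedEnvelopingAlgebra F p L}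
    (ha : a ∈ RestrictedEnvelopingAlgebra.augmentationIdeal F p L)
    (t : (isRestrictedModule_trivial F p L).AsModule) : a • t = 0 := by
  induction ha using Submodule.span_induction with
  | mem a ha =>
    obtain ⟨x, rfl⟩ := ha
    exact of_smul_trivial x t
  | zero => exact zero_smul _ t
  | add a b _ _ ha hb => rw [add_smul, ha, hb, add_zero]
  | smul c a _ ha => rw [smul_assoc, ha, smul_zero]

/-- Modulo the augmentation ideal `a` is a scalar, and this scalar is how `a` acts on the trivial
module. In particular the radical lies in the augmentation ideal. -/
theorem mem_augmentationIdeal_of_smul_eq_zero {a : RestrictedEnvelopingAlgebra F p L}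
    (ha : a • trivialOne F p L = 0) :
    a ∈ RestrictedEnvelopingAlgebra.augmentationIdeal F p L := by
  obtain ⟨c, hc⟩ := RestrictedEnvelopingAlgebra.exists_sub_algebraMap_mem_augmentationIdeal a
  have h := smul_eq_zero_of_mem_augmentationIdeal hc (trivialOne F p L)
  rw [sub_smul, ha, zero_sub, neg_eq_zero, algebraMap_smul] at h
  have hc0 : c = 0 := by
    have : c • (1 : F) = 0 := h
    simpa using this
  rw [hc0, map_zero, sub_zero] at hc
  exact hc

theorem jacobson_smul_trivial [FiniteDimensional F L] {j : RestrictedEnvelopingAlgebra F p L}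
    (hj : j ∈ Ring.jacobson (RestrictedEnvelopingAlgebra F p L))
    (t : (isRestrictedModule_trivial F p L).AsModule) : j • t = 0 := by
  have := isIrreducible_trivial (F := F) (p := p) (L := L)
  have := isSimpleModule_of_isIrreducible (S := (isRestrictedModule_trivial F p L).AsModule)
    (isRestrictedModule_trivial F p L).of_smul
  exact Module.mem_annihilator.mp (IsSemisimpleModule.jacobson_le_annihilator _
    (isRestrictedModule_trivial F p L).AsModule hj) t

variable [FiniteDimensional F L] [AddCommGroup S] [Module F S] [Module (RestrictedEnvelopingAlgebra F p L) S]
  [IsScalarTower F (RestrictedEnvelopingAlgebra F p L) S]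
  {P : Type*} [AddCommGroup P] [Module (RestrictedEnvelopingAlgebra F p L) P]
  {π : P →ₗ[RestrictedEnvelopingAlgebra F p L] (isRestrictedModule_trivial F p L).AsModule}

theorem IsProjectiveCover.ker_eq (hP : IsProjectiveCover π) :
    LinearMap.ker π = loewySeries (RestrictedEnvelopingAlgebra F p L) P 1 := by
  refine le_antisymm hP.ker_le ?_
  rw [loewySeries_one, Submodule.smul_le]
  intro j hj u _
  rw [LinearMap.mem_ker, map_smul, jacobson_smul_trivial hj]

theorem IsProjectiveCover.span_eq_top (hP : IsProjectiveCover π) {m : P}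
    (hm : π m = trivialOne F p L) :
    Submodule.span (RestrictedEnvelopingAlgebra F p L) {m} = ⊤ := by
  refine eq_top_of_sup_jacobson_smul_eq_top ?_
  rw [← loewySeries_one, ← hP.ker_eq, eq_top_iff]
  intro u _
  have h1 : u - (algebraMap F (RestrictedEnvelopingAlgebra F p L) (show F from π u)) • m ∈
      LinearMap.ker π := by
    rw [LinearMap.mem_ker, map_sub, map_smul, hm, algebraMap_smul, sub_eq_zero]
    exact (mul_one (show F from π u)).symm
  rw [← sub_add_cancel u ((algebraMap F (RestrictedEnvelopingAlgebra F p L)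
    (show F from π u)) • m)]
  exact add_mem (Submodule.mem_sup_right h1) (Submodule.mem_sup_left
    (Submodule.smul_mem _ _ (Submodule.mem_span_singleton_self m)))

theorem IsProjectiveCover.of_smul_mem (hP : IsProjectiveCover π) (m : P) (x : L) :
    RestrictedEnvelopingAlgebra.of F p x • m ∈
      loewySeries (RestrictedEnvelopingAlgebra F p L) P 1 := by
  rw [← hP.ker_eq, LinearMap.mem_ker, map_smul, of_smul_trivial]

/-- The derivation `x ↦ f (x m)` attached to a homomorphism `f` from the radical of the projective
cover of the trivial module and a generator `m` of that cover. -/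
def homToLinear (hP : IsProjectiveCover π) (m : P) :
    (loewySeries (RestrictedEnvelopingAlgebra F p L) P 1 →ₗ[RestrictedEnvelopingAlgebra F p L] S)
      →ₗ[F] (L →ₗ[F] S) where
  toFun f :=
    { toFun := fun x => f ⟨RestrictedEnvelopingAlgebra.of F p x • m, hP.of_smul_mem m x⟩
      map_add' := fun x y => by
        rw [← map_add]
        congr 1
        apply Subtype.ext
        simp only [← RestrictedEnvelopingAlgebra.ofLinear_apply, map_add, add_smul,
          Submodule.coe_add]
      map_smul' := fun c x => by
        have e : (⟨RestrictedEnvelopingAlgebra.of F p (c • x) • m, hP.of_smul_mem m _⟩ :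
            loewySeries (RestrictedEnvelopingAlgebra F p L) P 1) =
            algebraMap F (RestrictedEnvelopingAlgebra F p L) c •
              ⟨RestrictedEnvelopingAlgebra.of F p x • m, hP.of_smul_mem m x⟩ := by
          apply Subtype.ext
          change RestrictedEnvelopingAlgebra.of F p (c • x) • m =
            algebraMap F (RestrictedEnvelopingAlgebra F p L) c •
              RestrictedEnvelopingAlgebra.of F p x • m
          rw [← mul_smul, ← Algebra.smul_def,
            ← RestrictedEnvelopingAlgebra.ofLinear_apply, map_smul]
          rfl
        rw [e, map_smul, algebraMap_smul, RingHom.id_apply] }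
  map_add' _ _ := rfl
  map_smul' _ _ := rfl

theorem homToLinear_apply (hP : IsProjectiveCover π) (m : P)
    (f : loewySeries (RestrictedEnvelopingAlgebra F p L) P 1
      →ₗ[RestrictedEnvelopingAlgebra F p L] S) (x : L) :
    homToLinear hP m f x =
      f ⟨RestrictedEnvelopingAlgebra.of F p x • m, hP.of_smul_mem m x⟩ := rfl

variable [LieRingModule L S] [LieModule F L S]

theorem homToLinear_mem_restrictedCocycles
    (hc : ∀ (x : L) (s : S), RestrictedEnvelopingAlgebra.of F p x • s = ⁅x, s⁆)
    (hP : IsProjectiveCover π) (m : P)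
    (f : loewySeries (RestrictedEnvelopingAlgebra F p L) P 1
      →ₗ[RestrictedEnvelopingAlgebra F p L] S) :
    homToLinear hP m f ∈ restrictedCocycles F p L S := by
  refine ⟨fun x y => ?_, fun x => ?_⟩
  · rw [← hc, ← hc, homToLinear_apply, homToLinear_apply, homToLinear_apply, ← map_smul,
      ← map_smul, ← map_sub]
    congr 1
    apply Subtype.ext
    simp only [RestrictedEnvelopingAlgebra.of_lie, sub_smul, mul_smul, Submodule.coe_sub,
      Submodule.coe_smul]
  · rw [← of_pow_smul hc, homToLinear_apply, homToLinear_apply, ← map_smul]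
    congr 1
    apply Subtype.ext
    simp only [Submodule.coe_smul]
    rw [← RestrictedEnvelopingAlgebra.of_pow, ← mul_smul, ← pow_succ,
      Nat.sub_add_cancel (Fact.out : p.Prime).one_le]

/-- If `f (x m) = x s` for `x` in `L`, then `f (a m) = a s` for all `a` in the augmentation ideal.
This ideal contains `J`, and `J P = J m` because `m` generates `P`; so the values of `f` are of the
form `j s` with `j` in `J`, and `J` kills the simple module `S`. -/
theorem eq_zero_of_homToLinear_mem_lieCoboundaries [LieModule.IsIrreducible F L S]
    (hc : ∀ (x : L) (s : S), RestrictedEnvelopingAlgebra.of F p x • s = ⁅x, s⁆)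
    (hP : IsProjectiveCover π) {m : P} (hm : π m = trivialOne F p L)
    {f : loewySeries (RestrictedEnvelopingAlgebra F p L) P 1
      →ₗ[RestrictedEnvelopingAlgebra F p L] S}
    (hf : homToLinear hP m f ∈ lieCoboundaries F L S) : f = 0 := by
  have := isSimpleModule_of_isIrreducible hc
  obtain ⟨s, hs⟩ := mem_lieCoboundaries.mp hf
  have h1 : ∀ a ∈ RestrictedEnvelopingAlgebra.augmentationIdeal F p L,
      ∃ h : a • m ∈ loewySeries (RestrictedEnvelopingAlgebra F p L) P 1,
        f ⟨a • m, h⟩ = a • s := by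
    intro a ha
    induction ha using Submodule.span_induction with
    | mem a ha =>
      obtain ⟨x, rfl⟩ := ha
      exact ⟨hP.of_smul_mem m x, by rw [← homToLinear_apply hP, hs, hc]⟩
    | zero =>
      refine ⟨by rw [zero_smul]; exact zero_mem _, ?_⟩
      simp only [zero_smul]
      exact map_zero f
    | add a b _ _ ha hb =>
      obtain ⟨h, e⟩ := ha
      obtain ⟨h', e'⟩ := hb
      refine ⟨by rw [add_smul]; exact add_mem h h', ?_⟩
      refine (congrArg f (Subtype.ext (add_smul a b m) : _ = (⟨_, h⟩ + ⟨_, h'⟩ :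
        loewySeries (RestrictedEnvelopingAlgebra F p L) P 1))).trans ?_
      rw [map_add, e, e', add_smul]
    | smul c a _ ha =>
      obtain ⟨h, e⟩ := ha
      refine ⟨by rw [smul_assoc]; exact Submodule.smul_mem _ c h, ?_⟩
      refine (congrArg f (Subtype.ext (smul_assoc c a m) : _ = (c • ⟨_, h⟩ :
        loewySeries (RestrictedEnvelopingAlgebra F p L) P 1))).trans ?_
      rw [map_smul, e, smul_assoc]
  have h2 : ∀ u ∈ loewySeries (RestrictedEnvelopingAlgebra F p L) P 1,
      ∃ j ∈ Ring.jacobson (RestrictedEnvelopingAlgebra F p L), j • m = u := by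
    intro u hu
    rw [loewySeries_one] at hu
    induction hu using Submodule.smul_induction_on' with
    | smul j hj u _ =>
      have hu : u ∈ Submodule.span (RestrictedEnvelopingAlgebra F p L) {m} := by
        rw [hP.span_eq_top hm]
        trivial
      obtain ⟨a, rfl⟩ := Submodule.mem_span_singleton.mp hu
      exact ⟨j * a, Ideal.mul_mem_right _ _ hj, mul_smul j a m⟩
    | add u _ v _ hu hv =>
      obtain ⟨j, hj, rfl⟩ := hu
      obtain ⟨j', hj', rfl⟩ := hv
      exact ⟨j + j', add_mem hj hj', add_smul j j' m⟩
  ext ⟨u, hu⟩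
  obtain ⟨j, hj, rfl⟩ := h2 u hu
  obtain ⟨_, e⟩ := h1 j (mem_augmentationIdeal_of_smul_eq_zero (jacobson_smul_trivial hj _))
  rw [e]
  exact Module.mem_annihilator.mp (IsSemisimpleModule.jacobson_le_annihilator _ S hj) s

/-- The derivation makes `S × F` a restricted extension of the trivial module. Lifting `π` to `φ : P
→ S × F`, the radical, being the kernel of `π`, lands in `S`. With `φ m = (s, 1)`, one gets `φ (x m)
= x s + d x`, which is `d` up to an inner derivation. -/
theorem exists_homToLinear_sub_mem_lieCoboundaries
    (hc : ∀ (x : L) (s : S), RestrictedEnvelopingAlgebra.of F p x • s = ⁅x, s⁆)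
    (hP : IsProjectiveCover π) {m : P} (hm : π m = trivialOne F p L)
    {d : L →ₗ[F] S} (hd : d ∈ restrictedCocycles F p L S) :
    ∃ f : loewySeries (RestrictedEnvelopingAlgebra F p L) P 1
      →ₗ[RestrictedEnvelopingAlgebra F p L] S, homToLinear hP m f - d ∈ lieCoboundaries F L S := by
  have hp : p - 1 + 1 = p := Nat.sub_add_cancel (Fact.out : p.Prime).one_le
  let ρ := RestrictedEnvelopingAlgebra.lift (p := p) (extensionRep d hd.1) (by
    intro x
    refine LinearMap.ext fun v => ?_
    have h1 := extensionRep_pow_apply hd.1 x v (p - 1)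
    rw [hp] at h1
    rw [h1, extensionRep_apply, hd.2, ← hc, ← RestrictedEnvelopingAlgebra.of_pow,
      of_pow_smul hc])
  let _ : Module (RestrictedEnvelopingAlgebra F p L) (S × F) :=
    Module.compHom (S × F) ρ.toRingHom
  have hsmul : ∀ (a : RestrictedEnvelopingAlgebra F p L) (v : S × F), a • v = ρ a v :=
    fun _ _ => rfl
  have : IsScalarTower F (RestrictedEnvelopingAlgebra F p L) (S × F) :=
    ⟨fun c a v => by
      rw [hsmul, hsmul, map_smul]
      rfl⟩
  have hof : ∀ (x : L) (v : S × F),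
      RestrictedEnvelopingAlgebra.of F p x • v = (⁅x, v.1⁆ + v.2 • d x, 0) := fun x v => by
    rw [hsmul, RestrictedEnvelopingAlgebra.lift_of, extensionRep_apply]
  let q₀ : S × F →ₗ[F] (isRestrictedModule_trivial F p L).AsModule := LinearMap.snd F S F
  let q : S × F →ₗ[RestrictedEnvelopingAlgebra F p L]
      (isRestrictedModule_trivial F p L).AsModule :=
    { q₀ with
      map_smul' := RestrictedEnvelopingAlgebra.map_smul_of_map_of_smul q₀ fun x v => by
        rw [hof, of_smul_trivial]
        rfl }
  have hq : ∀ v, q v = v.2 := fun _ => rfl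
  let i : S →ₗ[RestrictedEnvelopingAlgebra F p L] S × F :=
    { LinearMap.inl F S F with
      map_smul' := RestrictedEnvelopingAlgebra.map_smul_of_map_of_smul (LinearMap.inl F S F)
        fun x s => by
          rw [hof, hc]
          simp }
  have hi : ∀ s, i s = (s, 0) := fun _ => rfl
  have := hP.projective
  obtain ⟨φ, hφ⟩ := Module.projective_lifting_property q π (fun t => ⟨(0, t), rfl⟩)
  have hφ' : ∀ u, (φ u).2 = π u := fun u => LinearMap.congr_fun hφ u
  have hφ0 : ∀ u : loewySeries (RestrictedEnvelopingAlgebra F p L) P 1,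
      φ u = i (φ u).1 := by
    rintro ⟨u, hu⟩
    rw [← hP.ker_eq, LinearMap.mem_ker] at hu
    exact Prod.ext rfl ((hφ' u).trans hu)
  let f : loewySeries (RestrictedEnvelopingAlgebra F p L) P 1
      →ₗ[RestrictedEnvelopingAlgebra F p L] S :=
    { toFun := fun u => (φ u).1
      map_add' := fun u v => by rw [Submodule.coe_add, map_add, Prod.fst_add]
      map_smul' := fun a u => by
        rw [Submodule.coe_smul, map_smul, hφ0 u, ← map_smul]
        rfl }
  refine ⟨f, mem_lieCoboundaries.mpr ⟨(φ m).1, fun x => ?_⟩⟩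
  have h1 : (φ m).2 = (1 : F) := (hφ' m).trans hm
  have h2 : homToLinear hP m f x = (φ (RestrictedEnvelopingAlgebra.of F p x • m)).1 := rfl
  rw [LinearMap.sub_apply, h2, map_smul, hof, h1, one_smul, add_sub_cancel_right]

theorem finrank_hom_add_finrank_lieCoboundaries [LieModule.IsIrreducible F L S]
    (hc : ∀ (x : L) (s : S), RestrictedEnvelopingAlgebra.of F p x • s = ⁅x, s⁆)
    (hS : IsRestrictedModule F p L S) (hP : IsProjectiveCover π) :
    Module.finrank F (loewySeries (RestrictedEnvelopingAlgebra F p L) P 1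
      →ₗ[RestrictedEnvelopingAlgebra F p L] S) + Module.finrank F (lieCoboundaries F L S) =
      Module.finrank F (restrictedCocycles F p L S) := by
  have := finiteDimensional_of_isIrreducible hc
  obtain ⟨m, hm⟩ := hP.surjective (trivialOne F p L)
  have hinj : Function.Injective (homToLinear (S := S) hP m) := by
    rw [← LinearMap.ker_eq_bot, eq_bot_iff]
    intro f hf
    refine eq_zero_of_homToLinear_mem_lieCoboundaries hc hP hm ?_
    rw [LinearMap.mem_ker.mp hf]
    exact zero_mem _
  have hinf : LinearMap.range (homToLinear (S := S) hP m) ⊓ lieCoboundaries F L S = ⊥ := by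
    rw [eq_bot_iff]
    rintro _ ⟨⟨f, rfl⟩, hf⟩
    rw [eq_zero_of_homToLinear_mem_lieCoboundaries hc hP hm hf, map_zero]
    exact zero_mem _
  have hsup : LinearMap.range (homToLinear (S := S) hP m) ⊔ lieCoboundaries F L S =
      restrictedCocycles F p L S := by
    refine le_antisymm (sup_le ?_ (lieCoboundaries_le_restrictedCocycles hS)) fun d hd => ?_
    · rintro _ ⟨f, rfl⟩
      exact homToLinear_mem_restrictedCocycles hc hP m f
    · obtain ⟨f, hf⟩ := exists_homToLinear_sub_mem_lieCoboundaries hc hP hm hd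
      rw [← sub_sub_cancel (homToLinear hP m f) d]
      exact sub_mem (Submodule.mem_sup_left ⟨f, rfl⟩) (Submodule.mem_sup_right hf)
  have := Submodule.finrank_sup_add_finrank_inf_eq
    (LinearMap.range (homToLinear (S := S) hP m)) (lieCoboundaries F L S)
  rw [hinf, hsup, finrank_bot, add_zero, LinearMap.finrank_range_of_inj hinj] at this
  exact this.symm

end ProjectiveCover

end EnvelopingAlgebra

/-! ### Trivial coefficients -/

section TrivialModule

variable {F L S : Type*} [Field F] [LieRing L] [AddCommGroup S] [Module F S]
  [LieRingModule L S]

theorem lie_eq_zero_of_equiv_trivial (e : S ≃ₗ⁅F,L⁆ TrivialLieModule F L F) (x : L) (s : S) :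
    ⁅x, s⁆ = 0 := by
  apply e.injective
  have h : e ⁅x, s⁆ = ⁅x, e s⁆ := e.toLieModuleHom.map_lie x s
  have h0 : e 0 = 0 := e.toLieModuleHom.map_zero
  rw [h, h0]
  exact trivial_lie_zero L (TrivialLieModule F L F) x (e s)

/-- Under a zero action every line is a submodule, so irreducibility forces dimension one. -/
theorem nonempty_equiv_trivial [LieModule.IsIrreducible F L S] (h : ∀ (x : L) (s : S), ⁅x, s⁆ = 0) :
    Nonempty (S ≃ₗ⁅F,L⁆ TrivialLieModule F L F) := by
  have : Nontrivial S := LieModule.nontrivial_of_isIrreducible F L S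
  obtain ⟨s, hs⟩ := exists_ne (0 : S)
  let N : LieSubmodule F L S :=
    { Submodule.span F {s} with
      lie_mem := fun {x t} _ => by
        rw [h]
        exact zero_mem (Submodule.span F {s}) }
  have hN : ∀ t, t ∈ N ↔ t ∈ Submodule.span F {s} := fun t => Iff.rfl
  have htop : Submodule.span F {s} = ⊤ := by
    rw [eq_top_iff]
    intro t _
    rw [← hN, (eq_bot_or_eq_top N).resolve_left fun hb => hs ?_]
    · exact LieSubmodule.mem_top t
    · rw [← LieSubmodule.mem_bot (R := F) (L := L) s, ← hb, hN]
      exact Submodule.mem_span_singleton_self s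
  let e : F ≃ₗ[F] S := (LinearEquiv.toSpanNonzeroSingleton F S s hs).trans
    (LinearEquiv.ofTop _ htop)
  let e' : S ≃ₗ[F] TrivialLieModule F L F := e.symm
  refine ⟨{ e' with map_lie' := ?_ }⟩
  intro x t
  change e' ⁅x, t⁆ = ⁅x, e' t⁆
  rw [h, map_zero]
  exact (trivial_lie_zero L (TrivialLieModule F L F) x (e' t)).symm

theorem finrank_eq_one_of_equiv_trivial (e : S ≃ₗ⁅F,L⁆ TrivialLieModule F L F) :
    Module.finrank F S = 1 :=
  e.toLinearEquiv.finrank_eq.trans (Module.finrank_self F)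

end TrivialModule

section TrivialCocycles

attribute [local instance] LieRing.ofAssociativeRing

variable {F L S : Type*} [Field F] [LieRing L] [LieAlgebra F L] [AddCommGroup S] [Module F S]
  [LieRingModule L S] [LieModule F L S]

theorem lieCoboundaries_eq_bot (h : ∀ (x : L) (s : S), ⁅x, s⁆ = 0) :
    lieCoboundaries F L S = ⊥ := by
  rw [eq_bot_iff]
  intro d hd
  obtain ⟨s, hs⟩ := mem_lieCoboundaries.mp hd
  exact LinearMap.ext fun x => by rw [hs, h]; rfl

theorem finrank_end_eq_one (h : ∀ (x : L) (s : S), ⁅x, s⁆ = 0) (h1 : Module.finrank F S = 1) :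
    Module.finrank F (S →ₗ⁅F,L⁆ S) = 1 := by
  let Φ : (S →ₗ⁅F,L⁆ S) →ₗ[F] (S →ₗ[F] S) :=
    { toFun := fun φ => (φ : S →ₗ[F] S)
      map_add' := fun _ _ => rfl
      map_smul' := fun _ _ => rfl }
  have : FiniteDimensional F S := Module.finite_of_finrank_eq_succ h1
  rw [(LinearEquiv.ofBijective Φ ⟨fun _ _ h => LieModuleHom.ext fun s => LinearMap.congr_fun h s,
    fun φ => ⟨{ φ with map_lie' := ?_ }, rfl⟩⟩).finrank_eq, Module.finrank_linearMap, h1]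
  intro x s
  change φ ⁅x, s⁆ = ⁅x, φ s⁆
  rw [h, h, map_zero]

/-- The dimension of the space of linear maps to a line that vanish on a subspace. -/
theorem finrank_add_finrank_of_forall_mem_iff {V : Type*} [AddCommGroup V] [Module F V]
    [FiniteDimensional F V] (h1 : Module.finrank F S = 1) (W : Submodule F V)
    (Z : Submodule F (V →ₗ[F] S)) (hZ : ∀ d, d ∈ Z ↔ ∀ x ∈ W, d x = 0) :
    Module.finrank F W + Module.finrank F Z = Module.finrank F V := by
  have : FiniteDimensional F S := Module.finite_of_finrank_eq_succ h1
  let Φ : ((V ⧸ W) →ₗ[F] S) →ₗ[F] Z :=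
    { toFun := fun g => ⟨g ∘ₗ W.mkQ, (hZ _).mpr fun x hx => by
        rw [LinearMap.comp_apply, Submodule.mkQ_apply, (Submodule.Quotient.mk_eq_zero W).mpr hx,
          map_zero]⟩
      map_add' := fun _ _ => rfl
      map_smul' := fun _ _ => rfl }
  have hbij : Function.Bijective Φ := by
    refine ⟨fun g g' h => Submodule.linearMap_qext _ (congrArg Subtype.val h), fun d => ?_⟩
    exact ⟨W.liftQ d ((hZ d).mp d.2), Subtype.ext (Submodule.liftQ_mkQ _ _ _)⟩
  rw [← (LinearEquiv.ofBijective Φ hbij).finrank_eq, Module.finrank_linearMap, h1, mul_one,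
    add_comm, Submodule.finrank_quotient_add_finrank]

theorem mem_lieCocycles_iff_of_trivial (h : ∀ (x : L) (s : S), ⁅x, s⁆ = 0) (d : L →ₗ[F] S) :
    d ∈ lieCocycles F L S ↔ ∀ x ∈ derivedSubspace F L, d x = 0 := by
  constructor
  · intro hd x hx
    rw [derivedSubspace, LieSubmodule.lieIdeal_oper_eq_linear_span] at hx
    induction hx using Submodule.span_induction with
    | mem x hx =>
      obtain ⟨y, z, rfl⟩ := hx
      rw [hd, h, h, sub_zero]
    | zero => exact map_zero d
    | add x y _ _ hx hy => rw [map_add, hx, hy, add_zero]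
    | smul c x _ hx => rw [map_smul, hx, smul_zero]
  · intro hd x y
    rw [h, h, sub_zero]
    exact hd _ (LieSubmodule.lie_mem_lie (LieSubmodule.mem_top x) (LieSubmodule.mem_top y))

theorem mem_restrictedCocycles_iff_of_trivial {p : ℕ} [Fact p.Prime] [RestrictedLieAlgebra F p L]
    (h : ∀ (x : L) (s : S), ⁅x, s⁆ = 0) (d : L →ₗ[F] S) :
    d ∈ restrictedCocycles F p L S ↔ ∀ x ∈ derivedSubspace F L ⊔ pMapSpan F p L, d x = 0 := by
  have hz : ∀ x : L, LieModule.toEnd F L S x = 0 := fun x => LinearMap.ext fun s => h x s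
  have hp : p - 1 ≠ 0 := by
    have := (Fact.out : p.Prime).two_le
    omega
  have h1 : d ∈ restrictedCocycles F p L S ↔
      d ∈ lieCocycles F L S ∧ ∀ x, d (pMap F p x) = 0 := by
    refine and_congr Iff.rfl (forall_congr' fun x => ?_)
    rw [hz, zero_pow hp, LinearMap.zero_apply]
  rw [h1, mem_lieCocycles_iff_of_trivial h]
  constructor
  · rintro ⟨hd, hd'⟩ x hx
    have : derivedSubspace F L ⊔ pMapSpan F p L ≤ LinearMap.ker d := by
      refine sup_le hd (Submodule.span_le.mpr ?_)
      rintro _ ⟨y, rfl⟩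
      exact hd' y
    exact this hx
  · intro hd
    exact ⟨fun x hx => hd x (Submodule.mem_sup_left hx),
      fun x => hd _ (Submodule.mem_sup_right (Submodule.subset_span ⟨x, rfl⟩))⟩

/-- The two dimensions are the codimensions of `[L, L]` and of its sum with the span of the `p`-th
powers; the dimension formula for sums and intersections gives the difference. -/
theorem finrank_lieCocycles_eq_restrictedCocycles_add {p : ℕ} [Fact p.Prime]
    [RestrictedLieAlgebra F p L] [FiniteDimensional F L] (h : ∀ (x : L) (s : S), ⁅x, s⁆ = 0)
    (h1 : Module.finrank F S = 1) :
    Module.finrank F (lieCocycles F L S) = Module.finrank F (restrictedCocycles F p L S) +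
      Module.finrank F (pMapSpan F p L ⧸
        (derivedSubspace F L ⊓ pMapSpan F p L).submoduleOf (pMapSpan F p L)) := by
  have e1 := finrank_add_finrank_of_forall_mem_iff h1 _ _ (mem_lieCocycles_iff_of_trivial h)
  have e2 := finrank_add_finrank_of_forall_mem_iff h1 _ _
    (mem_restrictedCocycles_iff_of_trivial (p := p) h)
  have e3 := Submodule.finrank_sup_add_finrank_inf_eq (derivedSubspace F L) (pMapSpan F p L)
  have e4 := Submodule.finrank_quotient_add_finrank
    ((derivedSubspace F L ⊓ pMapSpan F p L).submoduleOf (pMapSpan F p L))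
  rw [(Submodule.submoduleOfEquivOfLe
    (inf_le_right : derivedSubspace F L ⊓ pMapSpan F p L ≤ pMapSpan F p L)).finrank_eq] at e4
  omega

end TrivialCocycles

/-! ### The multiplicity formula -/

theorem proposition5p3 {F : Type*} [Field F] {p : ℕ} [Fact p.Prime] [CharP F p]
    {L : Type*} [LieRing L] [LieAlgebra F L] [FiniteDimensional F L] [LieAlgebra.IsSolvable L]
    [RestrictedLieAlgebra F p L]
    {S : Type*} [AddCommGroup S] [Module F S] [LieRingModule L S] [LieModule F L S]
    [LieModule.IsIrreducible F L S] (hS : IsRestrictedModule F p L S)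
    {P : Type*} [AddCommGroup P] [Module (RestrictedEnvelopingAlgebra F p L) P]
    (π : P →ₗ[RestrictedEnvelopingAlgebra F p L] (isRestrictedModule_trivial F p L).AsModule)
    (hP : IsProjectiveCover π) :
    IsFiniteLength (RestrictedEnvelopingAlgebra F p L)
      (SecondLoewyLayer (RestrictedEnvelopingAlgebra F p L) P) ∧
    ∀ s : CompositionSeries (Submodule (RestrictedEnvelopingAlgebra F p L)
        (SecondLoewyLayer (RestrictedEnvelopingAlgebra F p L) P)),
      s.head = ⊥ → s.last = ⊤ → ∀ c : ChiefSeries F L,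
        (¬ Nonempty (S ≃ₗ⁅F,L⁆ TrivialLieModule F L F) →
          compositionMultiplicity s hS.AsModule = c.splitMultiplicity S) ∧
        (Nonempty (S ≃ₗ⁅F,L⁆ TrivialLieModule F L F) →
          (compositionMultiplicity s hS.AsModule : ℤ) = (c.splitMultiplicity S : ℤ) -
            (Module.finrank F (pMapSpan F p L ⧸
              (derivedSubspace F L ⊓ pMapSpan F p L).submoduleOf (pMapSpan F p L)) : ℤ)) := by
  have hc := hS.of_smul
  change ∀ (x : L) (s : hS.AsModule),
    RestrictedEnvelopingAlgebra.of F p x • s = ⁅x, s⁆ at hc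
  have hirr : LieModule.IsIrreducible F L hS.AsModule :=
    inferInstanceAs (LieModule.IsIrreducible F L S)
  have hfin : FiniteDimensional F hS.AsModule := finiteDimensional_of_isIrreducible hc
  have hfinS : FiniteDimensional F S := hfin
  have hsimple := isSimpleModule_of_isIrreducible hc
  have hnontriv : Nontrivial S := LieModule.nontrivial_of_isIrreducible F L S
  have hss := isSemisimpleModule_secondLoewyLayer
    (A := RestrictedEnvelopingAlgebra F p L) (P := P)
  obtain ⟨m, hm⟩ := hP.surjective (trivialOne F p L)
  have hPfin : Module.Finite (RestrictedEnvelopingAlgebra F p L) P :=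
    ⟨⟨{m}, by rw [Finset.coe_singleton]; exact hP.span_eq_top hm⟩⟩
  refine ⟨isFiniteLength_secondLoewyLayer, fun s h0 h1 c => ?_⟩
  have hEnd : Module.Finite F (hS.AsModule →ₗ[RestrictedEnvelopingAlgebra F p L] hS.AsModule) := by
    let Φ : (hS.AsModule →ₗ[RestrictedEnvelopingAlgebra F p L] hS.AsModule) →ₗ[F]
        (hS.AsModule →ₗ[F] hS.AsModule) :=
      { toFun := fun φ => φ.restrictScalars F
        map_add' := fun _ _ => rfl
        map_smul' := fun _ _ => rfl }
    exact Module.Finite.of_injective Φ (LinearMap.restrictScalars_injective F)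
  have hmult := finrank_hom_eq_mul_compositionMultiplicity F (S := hS.AsModule) s h0 h1
  have hS' : IsRestrictedModule F p L hS.AsModule := hS
  have hres := finrank_hom_add_finrank_lieCoboundaries hc hS' hP
  have hend := finrank_end_eq hc
  have hsplit := finrank_lieCocycles_eq (S := S) c
  rw [finrank_hom_secondLoewyLayer, hend] at hmult
  rw [hmult] at hres
  change Module.finrank F (S →ₗ⁅F,L⁆ S) * compositionMultiplicity s hS.AsModule +
    Module.finrank F (lieCoboundaries F L S) = Module.finrank F (restrictedCocycles F p L S) at hres
  constructor
  · intro hnt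
    -- The whole algebra, as an ideal, acts nontrivially on `S`, so it has no nonzero invariants.
    have hinv : ∀ s : S, (∀ y : L, ⁅y, s⁆ = 0) → s = 0 := fun s hs =>
      eq_zero_of_ideal_lie_eq_zero (I := (⊤ : LieIdeal F L))
        (fun h => hnt (nonempty_equiv_trivial fun x t => h x (LieSubmodule.mem_top x) t))
        fun x _ => hs x
    have hZ : lieCocycles F L S = restrictedCocycles F p L S :=
      le_antisymm (lieCocycles_le_restrictedCocycles hS hinv) fun d hd => hd.1
    have hpos : 0 < Module.finrank F (S →ₗ⁅F,L⁆ S) := by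
      refine Module.finrank_pos_iff_exists_ne_zero.mpr ⟨LieModuleHom.id, fun h => ?_⟩
      obtain ⟨s, hs⟩ := exists_ne (0 : S)
      exact hs (LieModuleHom.congr_fun h s)
    rw [hZ, ← hres, add_comm] at hsplit
    exact Nat.eq_of_mul_eq_mul_left hpos (Nat.add_left_cancel hsplit)
  · rintro ⟨e⟩
    have htriv := lie_eq_zero_of_equiv_trivial e
    have hone := finrank_eq_one_of_equiv_trivial e
    have hdim := finrank_lieCocycles_eq_restrictedCocycles_add (p := p) htriv hone
    -- There are no inner derivations and the endomorphism space is a line, so both multiplicities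
    -- are dimensions of spaces of derivations.
    rw [lieCoboundaries_eq_bot htriv, finrank_bot, finrank_end_eq_one htriv hone] at hres hsplit
    omega
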